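/- **Theorem.** For a real number $x$ and an integer $k\ge 0$ put $\binom{x}{k}:=\frac{x(x-1)\cdots(x-k+1)}{k!}$ if $x\ge k$ and $\binom{x}{k}:=0$ if $x<k$. For a family $\mathcal F$ of subsets of $[n]=\{1,\dots,n\}$, the degree of $i\in[n]$ is the number of members of $\mathcal F$ containing $i$, and the diversity of $\mathcal F$ is $\gamma(\mathcal F):=\min_{i\in[n]}|\{F\in\mathcal F: i\notin F\}|$. Let $a,b$ be positive integers and $n\ge a+b$ an integer. Let $\mathcal A\subset\binom{[n]}{a}$ and $\mathcal B\subset\binom{[n]}{b}$ be cross-intersecting, that is, $A\cap B\neq\emptyset$ for all $A\in\mathcal A$, $B\in\mathcal B$. Suppose that for some real numbers $u,v$ with $3\le u\le a$ and $3\le v\le b$ we have $$|\mathcal A|\ \ge\ \binom{n-1}{a-1}-\binom{n-v-1}{a-1}+\binom{n-u-1}{n-a-1}\quad\text{and}\quad |\mathcal B|\ \ge\ \binom{n-1}{b-1}-\binom{n-u-1}{b-1}+\binom{n-v-1}{n-b-1},$$ and that at least one of these two inequalities is strict. Then $$\gamma(\mathcal A)<\binom{n-u-1}{n-a-1}\quad\text{and}\quad\gamma(\mathcal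 B)<\binom{n-v-1}{n-b-1}.$$ Moreover, each of the two families has a unique element of largest degree, and this element is the same for both families. -/

import Mathlib

open Finset

/-- The real binomial coefficient: `x (x - 1) ⋯ (x - k + 1) / k!` for real `x ≥ k`, and `0` for
`x < k`. -/
noncomputable def realChoose (x : ℝ) (k : ℕ) : ℝ :=
  if (k : ℝ) ≤ x then (∏ i ∈ Finset.range k, (x - (i : ℝ))) / (k.factorial : ℝ) else 0

/-- Every member of `A` meets every member of `B`. -/
def CrossIntersecting {n : ℕ} (A B : Finset (Finset (Fin n))) : Prop :=
  ∀ F ∈ A, ∀ G ∈ B, (F ∩ G).Nonempty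

/-- The degree of the element `i` in the family `F`: the number of members containing `i`. -/
def familyDegree {n : ℕ} (F : Finset (Finset (Fin n))) (i : Fin n) : ℕ :=
  (F.filter (fun S => i ∈ S)).card

/-- The diversity of a family on `n` points: the minimum over the elements `i` of the number of
members that do not contain `i` (for `n = 0` the value is the default `0`). -/
noncomputable def diversity {n : ℕ} (F : Finset (Finset (Fin n))) : ℕ :=
  ⨅ i : Fin n, (F.filter (fun S => i ∉ S)).card

/-- `i` is the unique element of largest degree in the family `F`. -/
def IsUniqueMaxDegree {n : ℕ} (F : Finset (Finset (Fin n))) (i : Fin n) : Prop :=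
  ∀ j : Fin n, j ≠ i → familyDegree F j < familyDegree F i

/-! Lower `n`, `a`, `b` by one: the ground set is {0, …, n}, the members have a + 1 and b + 1
elements, l = n - a - 1, l' = n - b - 1, t = n - u, t' = n - v. Write C(x, k) also for real x. Call
a point a center if fewer than C(t, l) members of A and fewer than C(t', l') members of B avoid it.
A center gives the theorem: it bounds both diversities, and since t, t' ≤ n - 3 its degree beats
that of every other point.

Two tools carry the proof. The first is Lovász's form of Kruskal–Katona, applied to complements
(`CrossMeet.card_add_binomPoly_le`): many members of A avoiding a point leave few members of B
through it. The second is that C(x, k) is a concave function of C(x, l) for k ≤ l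
(`concaveOn_lovaszBound`), so its slope is at least that of the chord from x = n - 3 to x = n - 2.
Since C(n-3, l-1) = C(n-3, a-1) and C(n-3, l'-1) = C(n-3, b-1), the chord slopes for the two
families are reciprocal. Weighting A by C(n-3, b-1) and B by C(n-3, a-1), gains and losses balance
exactly, and the one strict hypothesis gives a contradiction. The conditions u, v ≥ 3 put t and t'
to the left of this chord.

For shifted families 0 is a center (`shifted_bounds`), by induction on n. Pascal's rule splits the
size bound over the link and the deletion of the largest point, so one of the two parts of each
family is large again; these parts cross-intersect, and Kruskal–Katona carries the conclusion back.

General families are shifted step by step and the center is traced backwards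
(`isCenter_of_shiftFamily`). Only the shift i ← j with center i can lose it. Few sets then avoid
both i and j, and the traces on {i, j} show that i or j is avoided by at most C(n-2, l) and C(n-2,
l') members (`nonMember_small_or_small`); the reciprocal slopes leave no sizes between this and a
center (`nonMember_card_lt`). -/

/-! ### Binomial coefficients of a real variable -/

/-- The binomial coefficient `x (x - 1) ⋯ (x - k + 1) / k!` as a polynomial function of `x`. -/
noncomputable def binomPoly (x : ℝ) (k : ℕ) : ℝ :=
  (∏ i ∈ Finset.range k, (x - (i : ℝ))) / (k.factorial : ℝ)

lemma binomPoly_zero (x : ℝ) : binomPoly x 0 = 1 := by simp [binomPoly]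

lemma binomPoly_one (x : ℝ) : binomPoly x 1 = x := by simp [binomPoly]

lemma succ_mul_binomPoly_succ (x : ℝ) (k : ℕ) :
    ((k : ℝ) + 1) * binomPoly x (k + 1) = (x - k) * binomPoly x k := by
  have h1 : (k.factorial : ℝ) ≠ 0 := by positivity
  have h2 : (k : ℝ) + 1 ≠ 0 := by positivity
  simp only [binomPoly, Finset.prod_range_succ, Nat.factorial_succ, Nat.cast_mul, Nat.cast_add,
    Nat.cast_one]
  field_simp

lemma succ_mul_binomPoly_add_one_succ (x : ℝ) (k : ℕ) :
    ((k : ℝ) + 1) * binomPoly (x + 1) (k + 1) = (x + 1) * binomPoly x k := by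
  have h1 : (k.factorial : ℝ) ≠ 0 := by positivity
  have h2 : (k : ℝ) + 1 ≠ 0 := by positivity
  simp only [binomPoly, Finset.prod_range_succ', Nat.factorial_succ, Nat.cast_mul, Nat.cast_add,
    Nat.cast_one, Nat.cast_zero, sub_zero, add_sub_add_right_eq_sub]
  field_simp

lemma binomPoly_add_one_succ (x : ℝ) (k : ℕ) :
    binomPoly (x + 1) (k + 1) = binomPoly x k + binomPoly x (k + 1) := by
  have h2 : (k : ℝ) + 1 ≠ 0 := by positivity
  apply mul_left_cancel₀ h2
  rw [mul_add, succ_mul_binomPoly_add_one_succ, succ_mul_binomPoly_succ]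
  ring

/-- Pascal's rule, with the argument lowered. -/
lemma binomPoly_pascal (x : ℝ) (k : ℕ) :
    binomPoly x (k + 1) = binomPoly (x - 1) k + binomPoly (x - 1) (k + 1) := by
  have := binomPoly_add_one_succ (x - 1) k
  rwa [sub_add_cancel] at this

lemma binomPoly_natCast (n k : ℕ) : binomPoly (n : ℝ) k = (n.choose k : ℝ) := by
  induction n generalizing k with
  | zero =>
    cases k with
    | zero => simp [binomPoly]
    | succ k => simp [binomPoly, Finset.prod_range_succ']
  | succ n ih =>
    cases k with
    | zero => simp [binomPoly]
    | succ k =>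
      rw [Nat.cast_add, Nat.cast_one, binomPoly_add_one_succ, ih, ih, Nat.choose_succ_succ]
      push_cast; ring

lemma prod_range_pos {x : ℝ} {k : ℕ} (h : (k : ℝ) - 1 < x) :
    0 < ∏ i ∈ Finset.range k, (x - (i : ℝ)) := by
  apply Finset.prod_pos
  intro i hi
  have : (i : ℝ) + 1 ≤ k := by exact_mod_cast Finset.mem_range.mp hi
  linarith

lemma binomPoly_pos {x : ℝ} {k : ℕ} (h : (k : ℝ) - 1 < x) : 0 < binomPoly x k :=
  div_pos (prod_range_pos h) (by positivity)

lemma binomPoly_nonneg {x : ℝ} {k : ℕ} (h : (k : ℝ) - 1 ≤ x) : 0 ≤ binomPoly x k := by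
  apply div_nonneg _ (by positivity)
  apply Finset.prod_nonneg
  intro i hi
  have : (i : ℝ) + 1 ≤ k := by exact_mod_cast Finset.mem_range.mp hi
  linarith

lemma binomPoly_mono {x y : ℝ} {k : ℕ} (h : (k : ℝ) - 1 ≤ x) (hxy : x ≤ y) :
    binomPoly x k ≤ binomPoly y k := by
  apply div_le_div_of_nonneg_right _ (by positivity)
  apply Finset.prod_le_prod
  · intro i hi
    have : (i : ℝ) + 1 ≤ k := by exact_mod_cast Finset.mem_range.mp hi
    linarith
  · intro i _
    linarith

lemma binomPoly_strictMono {x y : ℝ} {k : ℕ} (hk : 1 ≤ k) (h : (k : ℝ) - 1 ≤ x) (hxy : x < y) :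
    binomPoly x k < binomPoly y k := by
  obtain ⟨k, rfl⟩ : ∃ m, k = m + 1 := ⟨k - 1, by omega⟩
  push_cast at h
  have h2 : (0 : ℝ) < (k : ℝ) + 1 := by positivity
  apply lt_of_mul_lt_mul_left _ h2.le
  rw [succ_mul_binomPoly_succ, succ_mul_binomPoly_succ]
  have h3 : binomPoly x k ≤ binomPoly y k := binomPoly_mono (by linarith) hxy.le
  have h4 : 0 < binomPoly y k := binomPoly_pos (by linarith)
  nlinarith

lemma continuous_binomPoly (k : ℕ) : Continuous fun x => binomPoly x k := by
  unfold binomPoly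
  fun_prop

lemma binomPoly_self (k : ℕ) : binomPoly (k : ℝ) k = 1 := by
  rw [binomPoly_natCast]; simp

lemma binomPoly_sub_one_self {k : ℕ} (hk : 1 ≤ k) : binomPoly ((k : ℝ) - 1) k = 0 := by
  obtain ⟨k, rfl⟩ : ∃ m, k = m + 1 := ⟨k - 1, by omega⟩
  have : (((k + 1 : ℕ) : ℝ) - 1) = (k : ℝ) := by push_cast; ring
  rw [this, binomPoly_natCast]; simp

lemma exists_binomPoly_eq {l : ℕ} (hl : 1 ≤ l) {x w : ℝ} (hx : (l : ℝ) - 1 ≤ x)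
    (hw : binomPoly x l ≤ w) : ∃ z, x ≤ z ∧ binomPoly z l = w := by
  obtain ⟨k, rfl⟩ : ∃ m, l = m + 1 := ⟨l - 1, by omega⟩
  push_cast at hx
  have h2 : (0 : ℝ) < (k : ℝ) + 1 := by positivity
  have hw0 : 0 ≤ w := le_trans (binomPoly_nonneg (by push_cast; linarith)) hw
  -- Large enough for the intermediate value theorem: the coefficient at `k` is at least 1 and y - k
  -- ≥ (k + 1) w.
  set y : ℝ := x + 1 + (k + 1) * w with hy
  have hxy : x ≤ y := by nlinarith
  have hyw : w ≤ binomPoly y (k + 1) := by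
    have h3 : (1 : ℝ) ≤ binomPoly y k := by
      rw [← binomPoly_self k]
      exact binomPoly_mono (by linarith) (by nlinarith)
    have h4 := succ_mul_binomPoly_succ y k
    have h5 : ((k : ℝ) + 1) * w ≤ ((k : ℝ) + 1) * binomPoly y (k + 1) := by
      rw [h4]; nlinarith
    exact le_of_mul_le_mul_left h5 h2
  obtain ⟨z, hz, hzw⟩ := intermediate_value_Icc hxy (continuous_binomPoly (k + 1)).continuousOn
    (show w ∈ Set.Icc (binomPoly x (k + 1)) (binomPoly y (k + 1)) from ⟨hw, hyw⟩)
  exact ⟨z, hz.1, hzw⟩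

/-! ### Concavity of one binomial coefficient in another -/

/-- Three-point form of the convexity of `1 / binomPoly · k`. -/
lemma binomPoly_inv_convex {k : ℕ} {x y z : ℝ} (hx : (k : ℝ) - 1 < x) (hxy : x ≤ y) (hyz : y ≤ z) :
    binomPoly x k * (y - x) * (binomPoly z k - binomPoly y k) ≤
      binomPoly z k * (z - y) * (binomPoly y k - binomPoly x k) := by
  induction k with
  | zero => simp [binomPoly_zero]
  | succ k ih =>
    push_cast at hx
    have hi := ih (by linarith)
    have h2 : (0 : ℝ) < (k : ℝ) + 1 := by positivity
    have ex := succ_mul_binomPoly_succ x k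
    have ey := succ_mul_binomPoly_succ y k
    have ez := succ_mul_binomPoly_succ z k
    have px : 0 < binomPoly x k := binomPoly_pos (by linarith)
    have mxy : binomPoly x k ≤ binomPoly y k := binomPoly_mono (by linarith) hxy
    have myz : binomPoly y k ≤ binomPoly z k := binomPoly_mono (by linarith) hyz
    set X := binomPoly x k
    set Y := binomPoly y k
    set Z := binomPoly z k
    -- The reciprocal at k + 1 is (k + 1)/(x - k) times the reciprocal at k, and a product of
    -- positive decreasing convex functions is convex; this is that fact with denominators cleared.
    have key : (x - k) * X * (y - x) * ((z - k) * Z - (y - k) * Y) ≤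
        (z - k) * Z * (z - y) * ((y - k) * Y - (x - k) * X) := by
      have a1 : 0 ≤ x - k := by linarith
      have a2 : 0 ≤ y - k := by linarith
      have a3 : 0 ≤ z - k := by linarith
      have b1 := mul_le_mul_of_nonneg_left hi (mul_nonneg a3 a2)
      have b2 : 0 ≤ (y - x) * (X * (y - x) * (Z - Y)) * (z - k) :=
        mul_nonneg (mul_nonneg (by linarith) (mul_nonneg (mul_nonneg px.le (by linarith))
          (by linarith))) a3
      have b3 : (x - k) * Y ≤ (z - k) * Z :=
        mul_le_mul (by linarith) myz (by linarith) a3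
      have b4 := mul_le_mul_of_nonneg_left b3
        (mul_nonneg (mul_nonneg px.le (sub_nonneg.2 hxy)) (sub_nonneg.2 hyz))
      nlinarith
    rw [← ex, ← ey, ← ez] at key
    have h3 : 0 < ((k : ℝ) + 1) * (k + 1) := by positivity
    apply le_of_mul_le_mul_left _ h3
    linarith

/-- One step of `binomPoly_slope`. -/
lemma binomPoly_slope_step {k : ℕ} {x y z : ℝ} (hx : (k : ℝ) - 1 < x) (hxy : x ≤ y)
    (hyz : y ≤ z) :
    (binomPoly y (k + 1) - binomPoly x (k + 1)) * (binomPoly z k - binomPoly y k) ≤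
      (binomPoly y k - binomPoly x k) * (binomPoly z (k + 1) - binomPoly y (k + 1)) := by
  have h2 : (0 : ℝ) < (k : ℝ) + 1 := by positivity
  have ex := succ_mul_binomPoly_succ x k
  have ey := succ_mul_binomPoly_succ y k
  have ez := succ_mul_binomPoly_succ z k
  -- Once `k + 1` is written through `k`, the common terms cancel and exactly this inequality
  -- remains.
  have h := binomPoly_inv_convex hx hxy hyz
  apply le_of_mul_le_mul_left _ h2
  have e1 : ((k : ℝ) + 1) * ((binomPoly y (k + 1) - binomPoly x (k + 1)) *
      (binomPoly z k - binomPoly y k)) =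
      ((y - k) * binomPoly y k - (x - k) * binomPoly x k) * (binomPoly z k - binomPoly y k) := by
    rw [← ex, ← ey]; ring
  have e2 : ((k : ℝ) + 1) * ((binomPoly y k - binomPoly x k) *
      (binomPoly z (k + 1) - binomPoly y (k + 1))) =
      (binomPoly y k - binomPoly x k) * ((z - k) * binomPoly z k - (y - k) * binomPoly y k) := by
    rw [← ez, ← ey]; ring
  rw [e1, e2]
  nlinarith

/-- `binomPoly · k` is a concave function of `binomPoly · l` for `k ≤ l`. -/
lemma binomPoly_slope {k l : ℕ} (hkl : k ≤ l) {x y z : ℝ} (hx : (l : ℝ) - 1 ≤ x) (hxy : x ≤ y)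
    (hyz : y ≤ z) :
    (binomPoly y l - binomPoly x l) * (binomPoly z k - binomPoly y k) ≤
      (binomPoly y k - binomPoly x k) * (binomPoly z l - binomPoly y l) := by
  rcases Nat.eq_zero_or_pos k with rfl | hk
  · simp [binomPoly_zero]
  rcases hyz.eq_or_lt with rfl | hyz'
  · simp
  induction l, hkl using Nat.le_induction with
  | base => rfl
  | succ l hl ih =>
    push_cast at hx
    have h1 := ih (by linarith)
    have h2 := binomPoly_slope_step (k := l) (by linarith) hxy hyz
    have b : 0 < binomPoly z l - binomPoly y l :=
      sub_pos.2 (binomPoly_strictMono (by omega) (by linarith) hyz')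
    have bk : 0 ≤ binomPoly z k - binomPoly y k := by
      have : (k : ℝ) ≤ l := by exact_mod_cast hl
      exact sub_nonneg.2 (binomPoly_mono (by linarith) hyz)
    have bl : 0 ≤ binomPoly z (l + 1) - binomPoly y (l + 1) :=
      sub_nonneg.2 (binomPoly_mono (by push_cast; linarith) hyz)
    -- Slopes multiply along the chain k, l, l + 1; the common increment at level `l` is cancelled.
    apply le_of_mul_le_mul_left _ b
    have c1 := mul_le_mul_of_nonneg_right h2 bk
    have c2 := mul_le_mul_of_nonneg_right h1 bl
    linarith

/-- The value at `w` of `binomPoly · k` as a function of `binomPoly · l`. -/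
noncomputable def lovaszBound (l k : ℕ) (w : ℝ) : ℝ :=
  open Classical in
  if h : ∃ z : ℝ, (l : ℝ) - 1 ≤ z ∧ binomPoly z l = w then binomPoly h.choose k else 0

lemma lovaszBound_binomPoly {l : ℕ} (hl : 1 ≤ l) (k : ℕ) {t : ℝ} (ht : (l : ℝ) - 1 ≤ t) :
    lovaszBound l k (binomPoly t l) = binomPoly t k := by
  have h : ∃ z : ℝ, (l : ℝ) - 1 ≤ z ∧ binomPoly z l = binomPoly t l := ⟨t, ht, rfl⟩
  rw [lovaszBound, dif_pos h]
  obtain ⟨h1, h2⟩ := h.choose_spec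
  rcases lt_trichotomy h.choose t with h3 | h3 | h3
  · exact absurd h2 (binomPoly_strictMono hl h1 h3).ne
  · rw [h3]
  · exact absurd h2 (binomPoly_strictMono hl ht h3).ne'

/-- The endpoint m = l - 1 is included, so the value at 0 is C(l-1, k), which need not vanish. -/
lemma lovaszBound_choose {l : ℕ} (hl : 1 ≤ l) (k m : ℕ) (hm : l ≤ m + 1) :
    lovaszBound l k (m.choose l : ℝ) = (m.choose k : ℝ) := by
  rw [← binomPoly_natCast, ← binomPoly_natCast]
  apply lovaszBound_binomPoly hl
  have : (l : ℝ) ≤ m + 1 := by exact_mod_cast hm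
  linarith

lemma exists_binomPoly_eq_of_nonneg {l : ℕ} (hl : 1 ≤ l) {w : ℝ} (hw : 0 ≤ w) :
    ∃ z, (l : ℝ) - 1 ≤ z ∧ binomPoly z l = w :=
  exists_binomPoly_eq hl le_rfl (by rwa [binomPoly_sub_one_self hl])

lemma le_of_binomPoly_le {l : ℕ} (hl : 1 ≤ l) {x y : ℝ} (hy : (l : ℝ) - 1 ≤ y)
    (h : binomPoly x l ≤ binomPoly y l) : x ≤ y := by
  by_contra hxy
  exact absurd h (not_le.2 (binomPoly_strictMono hl hy (not_le.1 hxy)))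

lemma lt_of_binomPoly_lt {l : ℕ} {x y : ℝ} (hy : (l : ℝ) - 1 ≤ y)
    (h : binomPoly x l < binomPoly y l) : x < y := by
  by_contra hxy
  exact absurd h (not_lt.2 (binomPoly_mono hy (not_lt.1 hxy)))

lemma lovaszBound_monotoneOn {l k : ℕ} (hl : 1 ≤ l) (hk : k ≤ l) :
    MonotoneOn (lovaszBound l k) (Set.Ici 0) := by
  intro x hx y hy hxy
  obtain ⟨s, hs, rfl⟩ := exists_binomPoly_eq_of_nonneg hl (Set.mem_Ici.1 hx)
  obtain ⟨t, ht, rfl⟩ := exists_binomPoly_eq_of_nonneg hl (Set.mem_Ici.1 hy)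
  rw [lovaszBound_binomPoly hl k hs, lovaszBound_binomPoly hl k ht]
  have : (k : ℝ) ≤ l := by exact_mod_cast hk
  exact binomPoly_mono (by linarith) (le_of_binomPoly_le hl ht hxy)

lemma lovaszBound_nonneg {l k : ℕ} (hl : 1 ≤ l) (hk : k ≤ l) {w : ℝ} (hw : 0 ≤ w) :
    0 ≤ lovaszBound l k w := by
  obtain ⟨s, hs, rfl⟩ := exists_binomPoly_eq_of_nonneg hl hw
  rw [lovaszBound_binomPoly hl k hs]
  have : (k : ℝ) ≤ l := by exact_mod_cast hk
  exact binomPoly_nonneg (by linarith)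

lemma concaveOn_lovaszBound {l k : ℕ} (hl : 1 ≤ l) (hk : k ≤ l) :
    ConcaveOn ℝ (Set.Ici 0) (lovaszBound l k) := by
  apply concaveOn_of_slope_anti_adjacent (convex_Ici 0)
  intro x y z hx hz hxy hyz
  have hy : 0 ≤ y := le_trans (Set.mem_Ici.1 hx) hxy.le
  rw [div_le_div_iff₀ (by linarith) (by linarith)]
  obtain ⟨r, hr, rfl⟩ := exists_binomPoly_eq_of_nonneg hl (Set.mem_Ici.1 hx)
  obtain ⟨s, hs, rfl⟩ := exists_binomPoly_eq_of_nonneg hl hy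
  obtain ⟨t, ht, rfl⟩ := exists_binomPoly_eq_of_nonneg hl (Set.mem_Ici.1 hz)
  rw [lovaszBound_binomPoly hl k hs, lovaszBound_binomPoly hl k hr, lovaszBound_binomPoly hl k ht]
  have := binomPoly_slope hk hr (le_of_binomPoly_le hl hs hxy.le) (le_of_binomPoly_le hl ht hyz.le)
  linarith

/-! ### Kruskal–Katona and cross-intersecting families -/

/-- Every member of `P` meets every member of `Q`. -/
def CrossMeet {α : Type*} (P Q : Finset (Finset α)) : Prop := ∀ X ∈ P, ∀ Y ∈ Q, ¬ Disjoint X Y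

lemma CrossMeet.symm {α : Type*} {P Q : Finset (Finset α)} (h : CrossMeet P Q) : CrossMeet Q P :=
  fun Y hY X hX hd => h X hX Y hY hd.symm

section KruskalKatona
variable {α : Type*} [DecidableEq α]

lemma card_filter_mem_eq (v : α) (F : Finset (Finset α)) :
    (F.memberSubfamily v).card = (F.filter (v ∈ ·)).card := by
  unfold Finset.memberSubfamily
  apply Finset.card_image_of_injOn
  intro X hX Y hY h
  simp only [Finset.coe_filter, Set.mem_ofPred_eq] at hX hY
  have h' : X.erase v = Y.erase v := h
  rw [← Finset.insert_erase hX.2, h', Finset.insert_erase hY.2]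

lemma sum_card_memberSubfamily {F : Finset (Finset α)} {k : ℕ}
    (hF : (F : Set (Finset α)).Sized k) {U : Finset α} (hU : ∀ X ∈ F, X ⊆ U) :
    ∑ v ∈ U, (F.memberSubfamily v).card = k * F.card := by
  simp_rw [card_filter_mem_eq, Finset.card_filter]
  rw [Finset.sum_comm, mul_comm, ← smul_eq_mul, ← Finset.sum_const]
  apply Finset.sum_congr rfl
  intro X hX
  rw [← Finset.card_filter, Finset.filter_mem_eq_inter, Finset.inter_eq_right.2 (hU X hX), hF hX]

lemma shadow_memberSubfamily_subset (v : α) (F : Finset (Finset α)) :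
    (F.memberSubfamily v).shadow ⊆ F.shadow.memberSubfamily v := by
  intro Y hY
  rw [Finset.mem_shadow_iff_insert_mem] at hY
  obtain ⟨a, ha, h⟩ := hY
  rw [Finset.mem_memberSubfamily] at h ⊢
  obtain ⟨h1, h2⟩ := h
  rw [Finset.mem_insert, not_or] at h2
  refine ⟨?_, h2.2⟩
  rw [Finset.mem_shadow_iff_insert_mem]
  refine ⟨a, ?_, ?_⟩
  · rw [Finset.mem_insert, not_or]; exact ⟨Ne.symm h2.1, ha⟩
  · rwa [Finset.insert_comm]

lemma memberSubfamily_subset_nonMemberSubfamily_shadow (v : α) (F : Finset (Finset α)) :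
    F.memberSubfamily v ⊆ F.shadow.nonMemberSubfamily v := by
  intro X hX
  rw [Finset.mem_memberSubfamily] at hX
  rw [Finset.mem_nonMemberSubfamily, Finset.mem_shadow_iff_insert_mem]
  exact ⟨⟨v, hX.2, hX.1⟩, hX.2⟩

lemma sized_memberSubfamily {F : Finset (Finset α)} {k : ℕ} (v : α)
    (hF : (F : Set (Finset α)).Sized (k + 1)) :
    ((F.memberSubfamily v : Finset (Finset α)) : Set (Finset α)).Sized k := by
  intro X hX
  rw [Finset.mem_coe, Finset.mem_memberSubfamily] at hX
  have := hF hX.1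
  rw [Finset.card_insert_of_notMem hX.2] at this
  omega

lemma shadow_nonempty_of_sized {F : Finset (Finset α)} {k : ℕ}
    (hF : (F : Set (Finset α)).Sized (k + 1)) (h : F.Nonempty) : F.shadow.Nonempty := by
  obtain ⟨X, hX⟩ := h
  have hc := hF hX
  obtain ⟨a, ha⟩ : X.Nonempty := Finset.card_pos.1 (by omega)
  exact ⟨_, Finset.erase_mem_shadow hX ha⟩

/-- A family of `(k + 2)`-sets with small shadow is small. -/
lemma card_le_of_card_shadow_le (k : ℕ) : ∀ (F : Finset (Finset α)),
    (F : Set (Finset α)).Sized (k + 2) → ∀ x : ℝ, (k : ℝ) + 1 ≤ x →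
    (F.shadow.card : ℝ) ≤ binomPoly x (k + 1) → (F.card : ℝ) ≤ binomPoly x (k + 2) := by
  induction k using Nat.strong_induction_on with
  | _ k ih =>
  intro F hF x hx hG
  -- A local inequality between the degree of `v` in `F` and in its shadow; summing over `v` counts
  -- each member k + 2 times and each shadow set k + 1 times.
  have claim : ∀ v : α, ((k : ℝ) + 1) * (F.memberSubfamily v).card ≤
      (x - (k + 1)) * (F.shadow.memberSubfamily v).card := by
    intro v
    have hFv := sized_memberSubfamily v hF
    -- If `v` has large degree in the shadow, the link of `v` lies among the shadow sets avoiding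
    -- `v`, and the total size of the shadow suffices. Otherwise the induction hypothesis applies to
    -- the link, whose shadow is small.
    rcases le_or_gt (binomPoly (x - 1) k) ((F.shadow.memberSubfamily v).card : ℝ) with h | h
    · have h1 : ((F.memberSubfamily v).card : ℝ) + (F.shadow.memberSubfamily v).card ≤
          F.shadow.card := by
        rw [← Finset.card_memberSubfamily_add_card_nonMemberSubfamily v F.shadow, add_comm]
        have := Finset.card_le_card (memberSubfamily_subset_nonMemberSubfamily_shadow v F)
        exact_mod_cast Nat.add_le_add_left this _
      have h2 := succ_mul_binomPoly_add_one_succ (x - 1) k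
      rw [sub_add_cancel] at h2
      have h3 : (0 : ℝ) ≤ k := by positivity
      have h4 := mul_le_mul_of_nonneg_left (h1.trans hG) (show (0 : ℝ) ≤ k + 1 by linarith)
      have h5 := mul_le_mul_of_nonneg_left h (show (0 : ℝ) ≤ x by linarith)
      linarith
    · have hsub := Finset.card_le_card (shadow_memberSubfamily_subset v F)
      rcases Nat.eq_zero_or_pos (F.shadow.memberSubfamily v).card with h0 | h0
      · have : F.memberSubfamily v = ∅ := by
          by_contra hne
          have := Finset.card_pos.2
            (shadow_nonempty_of_sized hFv (Finset.nonempty_iff_ne_empty.2 hne))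
          omega
        rw [this, h0]; simp
      · have h1 : (1 : ℝ) ≤ (F.shadow.memberSubfamily v).card := by exact_mod_cast h0
        rcases Nat.eq_zero_or_pos k with rfl | hk
        · rw [binomPoly_zero] at h; linarith
        · obtain ⟨y, hy, hyd⟩ := exists_binomPoly_eq (l := k) hk (x := k)
            (w := (F.shadow.memberSubfamily v).card) (by linarith) (by rwa [binomPoly_self])
          obtain ⟨j, rfl⟩ : ∃ j, k = j + 1 := ⟨k - 1, by omega⟩
          have h2 := ih j (by omega) _ hFv y (by exact_mod_cast hy)
            (by rw [hyd]; exact_mod_cast hsub)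
          have h3 := succ_mul_binomPoly_succ y (j + 1)
          have h4 : y < x - 1 := by
            apply lt_of_binomPoly_lt (l := j + 1) (by linarith)
            rwa [hyd]
          rw [hyd] at h3
          have h5 : (0 : ℝ) ≤ ((j + 1 : ℕ) : ℝ) + 1 := by positivity
          have h6 := mul_le_mul_of_nonneg_left h2 h5
          refine h6.trans (h3.le.trans ?_)
          apply mul_le_mul_of_nonneg_right _ (by linarith)
          linarith
  have hU : ∀ X ∈ F, X ⊆ F.biUnion id := fun X hX => Finset.subset_biUnion_of_mem id hX
  have hU' : ∀ X ∈ F.shadow, X ⊆ F.biUnion id := by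
    intro X hX
    obtain ⟨Y, hY, hXY⟩ := Finset.exists_subset_of_mem_shadow hX
    exact hXY.trans (hU Y hY)
  have s1 := sum_card_memberSubfamily hF hU
  have s2 := sum_card_memberSubfamily (k := k + 1) hF.shadow hU'
  have s3 := Finset.sum_le_sum (s := F.biUnion id) fun v _ => claim v
  rw [← Finset.mul_sum, ← Finset.mul_sum, ← Nat.cast_sum, ← Nat.cast_sum, s1, s2] at s3
  have h3 := succ_mul_binomPoly_succ x (k + 1)
  push_cast at s3 h3
  have h4 : (0 : ℝ) < ((k : ℝ) + 1) * (k + 2) := by positivity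
  apply le_of_mul_le_mul_left _ h4
  have h5 := mul_le_mul_of_nonneg_left hG
    (mul_nonneg (show (0 : ℝ) ≤ x - (k + 1) by linarith) (show (0 : ℝ) ≤ (k : ℝ) + 1 by positivity))
  have h6 : ((k : ℝ) + 1) * (k + 2) * binomPoly x (k + 2) =
      (k + 1) * ((x - (k + 1)) * binomPoly x (k + 1)) := by
    rw [← h3]; ring
  rw [h6]
  linarith

/-- **Lovász's form of the Kruskal–Katona theorem** with a real parameter, one step. -/
lemma binomPoly_le_card_shadow {F : Finset (Finset α)} {l : ℕ}
    (hF : (F : Set (Finset α)).Sized (l + 1)) (hne : F.Nonempty) {x : ℝ} (hx : (l : ℝ) ≤ x)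
    (h : binomPoly x (l + 1) ≤ F.card) : binomPoly x l ≤ F.shadow.card := by
  have hs : (1 : ℝ) ≤ F.shadow.card := by
    exact_mod_cast Finset.card_pos.2 (shadow_nonempty_of_sized hF hne)
  -- For x ≤ l + 1 a single member already contributes l + 1 sets to the shadow.
  rcases le_or_gt x (l + 1) with hx1 | hx1
  · obtain ⟨X, hX⟩ := hne
    have hc := hF hX
    have h1 : X.powersetCard l ⊆ F.shadow := by
      intro Y hY
      rw [Finset.mem_powersetCard] at hY
      rw [Finset.mem_shadow_iff_exists_mem_card_add_one]
      exact ⟨X, hX, hY.1, by omega⟩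
    have h2 := Finset.card_le_card h1
    rw [Finset.card_powersetCard, hc] at h2
    calc binomPoly x l ≤ binomPoly ((l + 1 : ℕ) : ℝ) l :=
          binomPoly_mono (by linarith) (by push_cast; exact hx1)
      _ = ((l + 1).choose l : ℝ) := binomPoly_natCast _ _
      _ ≤ F.shadow.card := by exact_mod_cast h2
  · cases l with
    | zero => rwa [binomPoly_zero]
    | succ k =>
      by_contra hlt
      push Not at hlt
      obtain ⟨y, hy, hyd⟩ := exists_binomPoly_eq (l := k + 1) (by omega) (x := (k + 1 : ℕ))
        (w := F.shadow.card) (by linarith) (by rwa [binomPoly_self])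
      have h1 := card_le_of_card_shadow_le k F hF y (by exact_mod_cast hy) hyd.ge
      have h2 : y < x := lt_of_binomPoly_lt (l := k + 1) (by linarith) (by rwa [hyd])
      have h3 : binomPoly y (k + 2) < binomPoly x (k + 2) :=
        binomPoly_strictMono (by omega) (by push_cast at hy ⊢; linarith) h2
      linarith

/-- **Lovász's form of the Kruskal–Katona theorem** with a real parameter, iterated. -/
lemma binomPoly_le_card_shadow_iterate (j : ℕ) : ∀ {F : Finset (Finset α)} {q : ℕ},
    (F : Set (Finset α)).Sized (q + j) → F.Nonempty → ∀ {x : ℝ}, ((q + j : ℕ) : ℝ) - 1 ≤ x →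
    binomPoly x (q + j) ≤ F.card → binomPoly x q ≤ (Finset.shadow^[j] F).card := by
  induction j with
  | zero => intro F q _ _ x _ h; simpa using h
  | succ j ih =>
    intro F q hF hne x hx h
    rw [Function.iterate_succ_apply]
    have hx' : ((q + j : ℕ) : ℝ) ≤ x := by push_cast at hx ⊢; linarith
    exact ih hF.shadow (shadow_nonempty_of_sized hF hne) (by linarith)
      (binomPoly_le_card_shadow hF hne hx' h)

/-- Cross-intersecting families: if one is large, then the other is small. -/
lemma CrossMeet.card_add_binomPoly_le {P Q : Finset (Finset α)} (h : CrossMeet P Q)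
    {V : Finset α} {p q l m : ℕ} (hP : P ⊆ V.powersetCard p) (hQ : Q ⊆ V.powersetCard q)
    (hm : V.card = m) (hl : p + l = m) (hq : q ≤ l) (hne : P.Nonempty) {x : ℝ}
    (hx : (l : ℝ) - 1 ≤ x) (hcard : binomPoly x l ≤ P.card) :
    (Q.card : ℝ) + binomPoly x q ≤ (m.choose q : ℝ) := by
  obtain ⟨j, rfl⟩ : ∃ j, l = q + j := ⟨l - q, by omega⟩
  -- A set of `Q` meets `X` exactly when it is not inside the complement of `X`, so `Q` is disjoint
  -- from the iterated shadow of the complements.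
  set F : Finset (Finset α) := P.image (V \ ·) with hFdef
  have hFcard : F.card = P.card := by
    apply Finset.card_image_of_injOn
    intro X hX Y hY hXY
    have hX' := (Finset.mem_powersetCard.1 (hP hX)).1
    have hY' := (Finset.mem_powersetCard.1 (hP hY)).1
    have hXY' : V \ X = V \ Y := hXY
    rw [← Finset.sdiff_sdiff_eq_self hX', hXY', Finset.sdiff_sdiff_eq_self hY']
  have hFs : (F : Set (Finset α)).Sized (q + j) := by
    intro Z hZ
    rw [Finset.mem_coe, Finset.mem_image] at hZ
    obtain ⟨X, hX, rfl⟩ := hZ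
    have hX' := Finset.mem_powersetCard.1 (hP hX)
    rw [Finset.card_sdiff_of_subset hX'.1, hm, hX'.2]
    omega
  have hsh := binomPoly_le_card_shadow_iterate j hFs (hne.image _) hx (by rwa [hFcard])
  have hdisj : Disjoint Q (Finset.shadow^[j] F) := by
    rw [Finset.disjoint_left]
    intro Y hY hYs
    rw [Finset.mem_shadow_iterate_iff_exists_sdiff] at hYs
    obtain ⟨Z, hZ, hYZ, -⟩ := hYs
    rw [Finset.mem_image] at hZ
    obtain ⟨X, hX, rfl⟩ := hZ
    exact h X hX Y hY (Finset.disjoint_of_subset_right hYZ Finset.disjoint_sdiff)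
  have hsub : Q ∪ Finset.shadow^[j] F ⊆ V.powersetCard q := by
    apply Finset.union_subset hQ
    intro Y hYs
    rw [Finset.mem_shadow_iterate_iff_exists_sdiff] at hYs
    obtain ⟨Z, hZ, hYZ, hc⟩ := hYs
    have hZc := hFs hZ
    rw [Finset.mem_image] at hZ
    obtain ⟨X, hX, rfl⟩ := hZ
    rw [Finset.mem_powersetCard]
    refine ⟨hYZ.trans Finset.sdiff_subset, ?_⟩
    rw [Finset.card_sdiff_of_subset hYZ] at hc
    have := Finset.card_le_card hYZ
    omega
  have h1 := Finset.card_le_card hsub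
  rw [Finset.card_union_of_disjoint hdisj, Finset.card_powersetCard, hm] at h1
  have h2 : (Q.card : ℝ) + (Finset.shadow^[j] F).card ≤ (m.choose q : ℝ) := by exact_mod_cast h1
  linarith

/-- Nonemptiness matters: the bound at 0 can be positive, while an empty `P` puts no restriction on
`Q`. -/
lemma CrossMeet.card_add_lovaszBound_le {P Q : Finset (Finset α)} (h : CrossMeet P Q)
    {V : Finset α} {p q l m : ℕ} (hP : P ⊆ V.powersetCard p) (hQ : Q ⊆ V.powersetCard q)
    (hm : V.card = m) (hl : p + l = m) (hl1 : 1 ≤ l) (hq : q ≤ l) (hne : P.Nonempty) :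
    (Q.card : ℝ) + lovaszBound l q P.card ≤ (m.choose q : ℝ) := by
  obtain ⟨z, hz, hzP⟩ := exists_binomPoly_eq_of_nonneg hl1 (Nat.cast_nonneg P.card)
  rw [← hzP, lovaszBound_binomPoly hl1 q hz]
  exact h.card_add_binomPoly_le hP hQ hm hl hq hne hz hzP.le

end KruskalKatona

/-! ### Comparison of chords -/

/-- The slopes over [w, x] and [y, z], which may overlap, are both compared with the slope over [w,
z]. -/
lemma ConcaveOn.chord_le {f : ℝ → ℝ} (hf : ConcaveOn ℝ (Set.Ici 0) f) {w x y z : ℝ} (hw : 0 ≤ w)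
    (hwx : w ≤ x) (hwy : w ≤ y) (hxz : x ≤ z) (hyz : y < z) :
    (f z - f y) * (x - w) ≤ (f x - f w) * (z - y) := by
  rcases hwx.eq_or_lt with rfl | hwx'
  · simp
  have hg := hf.neg
  have hwz : w < z := lt_of_lt_of_le hwx' hxz
  have m1 : w ∈ Set.Ici (0 : ℝ) := hw
  have m2 : x ∈ Set.Ici (0 : ℝ) := hw.trans hwx
  have m3 : y ∈ Set.Ici (0 : ℝ) := hw.trans hwy
  have m4 : z ∈ Set.Ici (0 : ℝ) := hw.trans hwz.le
  have h1 := hg.secant_mono m1 m2 m4 hwx'.ne' hwz.ne' hxz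
  have h2 := hg.secant_mono m4 m1 m3 hwz.ne hyz.ne hwy
  simp only [Pi.neg_apply] at h1 h2
  have e1 : (-f w - -f z) / (w - z) = (-f z - -f w) / (z - w) := by
    rw [← neg_div_neg_eq]; congr 1 <;> ring
  have e2 : (-f y - -f z) / (y - z) = (-f z - -f y) / (z - y) := by
    rw [← neg_div_neg_eq]; congr 1 <;> ring
  rw [e1, e2] at h2
  have h3 := h1.trans h2
  rw [div_le_div_iff₀ (by linarith) (by linarith)] at h3
  linarith

/-- Concavity against the reference chord from `N` to N + 1, whose increments are given by Pascal's
rule. It is used with N = n - 3. -/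
lemma binomPoly_chord {k l N : ℕ} (hk : 1 ≤ k) (hkl : k ≤ l) {x y : ℝ} (hx : (l : ℝ) - 1 ≤ x)
    (hxy : x ≤ y) (hxN : x ≤ N) (hyN : y ≤ N + 1) :
    (N.choose (k - 1) : ℝ) * (binomPoly y l - binomPoly x l) ≤
      (N.choose (l - 1) : ℝ) * (binomPoly y k - binomPoly x k) := by
  have hl : 1 ≤ l := hk.trans hkl
  have hlN : l ≤ N + 1 := by
    have : (l : ℝ) ≤ N + 1 := by linarith
    exact_mod_cast this
  have hc := concaveOn_lovaszBound hl hkl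
  have h1 : binomPoly x l ≤ (N.choose l : ℝ) := by
    rw [← binomPoly_natCast]; exact binomPoly_mono hx hxN
  have h2 : binomPoly y l ≤ ((N + 1).choose l : ℝ) := by
    rw [← binomPoly_natCast]; push_cast; exact binomPoly_mono (hx.trans hxy) hyN
  obtain ⟨k, rfl⟩ : ∃ j, k = j + 1 := ⟨k - 1, by omega⟩
  obtain ⟨l, rfl⟩ : ∃ j, l = j + 1 := ⟨l - 1, by omega⟩
  have hpos : 0 < N.choose l := Nat.choose_pos (by omega)
  have h3 : (N.choose (l + 1) : ℝ) < ((N + 1).choose (l + 1) : ℝ) := by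
    rw [Nat.choose_succ_succ' N l]; exact_mod_cast (by omega)
  have h := hc.chord_le (binomPoly_nonneg hx) (binomPoly_mono hx hxy) h1 h2 h3
  rw [lovaszBound_choose hl _ _ (by omega), lovaszBound_choose hl _ _ (by omega),
    lovaszBound_binomPoly hl _ hx, lovaszBound_binomPoly hl _ (hx.trans hxy),
    Nat.choose_succ_succ' N l, Nat.choose_succ_succ' N k] at h
  push_cast at h
  simp only [Nat.add_sub_cancel]
  linarith

/-! ### Shifted families, links and deletions -/

/-- A family is shifted if replacing an element of a member by a smaller one gives a member. -/
def Shifted (A : Finset (Finset ℕ)) : Prop :=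
  ∀ X ∈ A, ∀ i j, i < j → j ∈ X → i ∉ X → insert i (X.erase j) ∈ A

lemma Shifted.insert_mem {A : Finset (Finset ℕ)} (h : Shifted A) {X : Finset ℕ} {i j : ℕ}
    (hX : insert j X ∈ A) (hj : j ∉ X) (hij : i < j) (hi : i ∉ X) : insert i X ∈ A := by
  have := h _ hX i j hij (Finset.mem_insert_self _ _) (by
    rw [Finset.mem_insert, not_or]; exact ⟨hij.ne, hi⟩)
  rwa [Finset.erase_insert hj] at this

lemma Shifted.memberSubfamily {A : Finset (Finset ℕ)} (h : Shifted A) {n : ℕ}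
    (hA : ∀ X ∈ A, X ⊆ range (n + 1)) : Shifted (A.memberSubfamily n) := by
  intro X hX i j hij hj hi
  rw [Finset.mem_memberSubfamily] at hX ⊢
  have hjn : j ≠ n := fun e => hX.2 (e ▸ hj)
  have hjn' : j < n + 1 := Finset.mem_range.1 (hA _ hX.1 (Finset.mem_insert_of_mem hj))
  have hin : i ≠ n := by omega
  have h1 := h _ hX.1 i j hij (Finset.mem_insert_of_mem hj)
    (by rw [Finset.mem_insert, not_or]; exact ⟨hin, hi⟩)
  rw [Finset.erase_insert_of_ne hjn.symm, Finset.insert_comm] at h1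
  refine ⟨h1, ?_⟩
  rw [Finset.mem_insert, not_or, Finset.mem_erase, not_and]
  exact ⟨hin.symm, fun _ => hX.2⟩

lemma Shifted.nonMemberSubfamily {A : Finset (Finset ℕ)} (h : Shifted A) {n : ℕ}
    (hA : ∀ X ∈ A, X ⊆ range (n + 1)) : Shifted (A.nonMemberSubfamily n) := by
  intro X hX i j hij hj hi
  rw [Finset.mem_nonMemberSubfamily] at hX ⊢
  have hjn' : j < n + 1 := Finset.mem_range.1 (hA _ hX.1 hj)
  refine ⟨h _ hX.1 i j hij hj hi, ?_⟩
  rw [Finset.mem_insert, not_or, Finset.mem_erase, not_and]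
  exact ⟨by omega, fun _ => hX.2⟩

section Subfamilies
variable {α : Type*} [DecidableEq α]

lemma memberSubfamily_subset_powersetCard {A : Finset (Finset α)} {V : Finset α} {a : ℕ} (v : α)
    (hA : A ⊆ V.powersetCard (a + 1)) : A.memberSubfamily v ⊆ (V.erase v).powersetCard a := by
  intro X hX
  rw [Finset.mem_memberSubfamily] at hX
  have h := Finset.mem_powersetCard.1 (hA hX.1)
  rw [Finset.card_insert_of_notMem hX.2] at h
  rw [Finset.mem_powersetCard]
  refine ⟨?_, by omega⟩
  rw [Finset.subset_erase]
  exact ⟨(Finset.subset_insert _ _).trans h.1, hX.2⟩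

lemma nonMemberSubfamily_subset_powersetCard {A : Finset (Finset α)} {V : Finset α} {a : ℕ}
    (v : α) (hA : A ⊆ V.powersetCard a) :
    A.nonMemberSubfamily v ⊆ (V.erase v).powersetCard a := by
  intro X hX
  rw [Finset.mem_nonMemberSubfamily] at hX
  have h := Finset.mem_powersetCard.1 (hA hX.1)
  rw [Finset.mem_powersetCard, Finset.subset_erase]
  exact ⟨⟨h.1, hX.2⟩, h.2⟩

lemma CrossMeet.member_nonMember {A B : Finset (Finset α)} (h : CrossMeet A B) (v : α) :
    CrossMeet (A.memberSubfamily v) (B.nonMemberSubfamily v) := by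
  intro X hX Y hY hd
  rw [Finset.mem_memberSubfamily] at hX
  rw [Finset.mem_nonMemberSubfamily] at hY
  exact h _ hX.1 _ hY.1 (Finset.disjoint_insert_left.2 ⟨hY.2, hd⟩)

lemma CrossMeet.nonMember_member {A B : Finset (Finset α)} (h : CrossMeet A B) (v : α) :
    CrossMeet (A.nonMemberSubfamily v) (B.memberSubfamily v) :=
  (h.symm.member_nonMember v).symm

lemma CrossMeet.nonMember_nonMember {A B : Finset (Finset α)} (h : CrossMeet A B) (v : α) :
    CrossMeet (A.nonMemberSubfamily v) (B.nonMemberSubfamily v) := by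
  intro X hX Y hY
  exact h _ (Finset.mem_nonMemberSubfamily.1 hX).1 _ (Finset.mem_nonMemberSubfamily.1 hY).1

lemma memberSubfamily_comm (A : Finset (Finset α)) {u v : α} (huv : u ≠ v) :
    (A.memberSubfamily u).memberSubfamily v = (A.memberSubfamily v).memberSubfamily u := by
  ext X
  simp only [Finset.mem_memberSubfamily, Finset.mem_insert, not_or, Finset.insert_comm u v]
  tauto

lemma member_nonMember_comm (A : Finset (Finset α)) {u v : α} (huv : u ≠ v) :
    (A.memberSubfamily u).nonMemberSubfamily v = (A.nonMemberSubfamily v).memberSubfamily u := by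
  ext X
  simp only [Finset.mem_memberSubfamily, Finset.mem_nonMemberSubfamily, Finset.mem_insert, not_or]
  have := huv.symm
  tauto

lemma nonMemberSubfamily_comm (A : Finset (Finset α)) (u v : α) :
    (A.nonMemberSubfamily u).nonMemberSubfamily v =
      (A.nonMemberSubfamily v).nonMemberSubfamily u := by
  ext X
  simp only [Finset.mem_nonMemberSubfamily]
  tauto

lemma cast_card_member_add_nonMember (v : α) (A : Finset (Finset α)) :
    ((A.memberSubfamily v).card : ℝ) + (A.nonMemberSubfamily v).card = A.card := by
  exact_mod_cast Finset.card_memberSubfamily_add_card_nonMemberSubfamily v A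

lemma card_image_sdiff_left {F : Finset (Finset α)} {V : Finset α} (hF : ∀ X ∈ F, X ⊆ V) :
    (F.image (V \ ·)).card = F.card := by
  apply Finset.card_image_of_injOn
  intro X hX Y hY hXY
  have hXY' : V \ X = V \ Y := hXY
  rw [← Finset.sdiff_sdiff_eq_self (hF X hX), hXY', Finset.sdiff_sdiff_eq_self (hF Y hY)]

end Subfamilies

lemma card_range_erase_zero (n : ℕ) : ((range (n + 1)).erase 0).card = n := by
  rw [Finset.card_erase_of_mem (by simp)]; simp

/-! ### Large pairs of families -/

/-- The lower bound on the size of a family of `(a + 1)`-subsets of an `(n + 1)`-set. -/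
noncomputable def sizeBound (n a l : ℕ) (t t' : ℝ) : ℝ :=
  (n.choose a : ℝ) - binomPoly t' a + binomPoly t l

/-- Cross-intersecting families of `(a + 1)`- and `(b + 1)`-subsets of `{0, …, n}` of sizes at least
the bounds with parameters `t`, `t'`. -/
structure LargePair (n a b l l' : ℕ) (t t' : ℝ) (A B : Finset (Finset ℕ)) : Prop where
  hal : a + l + 1 = n
  hbl : b + l' + 1 = n
  hab : a + b + 1 ≤ n
  ha : 1 ≤ a
  hb : 1 ≤ b
  subA : A ⊆ (range (n + 1)).powersetCard (a + 1)
  subB : B ⊆ (range (n + 1)).powersetCard (b + 1)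
  cross : CrossMeet A B
  ht : (l : ℝ) - 1 ≤ t
  ht' : (l' : ℝ) - 1 ≤ t'
  htn : t ≤ n - 3
  htn' : t' ≤ n - 3
  cardA : sizeBound n a l t t' ≤ A.card
  cardB : sizeBound n b l' t' t ≤ B.card
  strict : sizeBound n a l t t' < A.card ∨ sizeBound n b l' t' t < B.card
  -- The induction can bring `t` into the window [l - 1, l), where C(t, l) may vanish; strictness
  -- makes up for that.
  strictA : t < l → sizeBound n a l t t' < A.card
  strictB : t' < l' → sizeBound n b l' t' t < B.card

namespace LargePair

variable {n a b l l' : ℕ} {t t' : ℝ} {A B : Finset (Finset ℕ)}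

lemma symm (h : LargePair n a b l l' t t' A B) : LargePair n b a l' l t' t B A where
  hal := h.hbl
  hbl := h.hal
  hab := by have := h.hab; omega
  ha := h.hb
  hb := h.ha
  subA := h.subB
  subB := h.subA
  cross := h.cross.symm
  ht := h.ht'
  ht' := h.ht
  htn := h.htn'
  htn' := h.htn
  cardA := h.cardB
  cardB := h.cardA
  strict := h.strict.symm
  strictA := h.strictB
  strictB := h.strictA

lemma a_le (h : LargePair n a b l l' t t' A B) : a ≤ l' := by
  have := h.hab; have := h.hbl; omega

lemma b_le (h : LargePair n a b l l' t t' A B) : b ≤ l := h.symm.a_le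

lemma sub_member (h : LargePair n a b l l' t t' A B) (v : ℕ) :
    A.memberSubfamily v ⊆ ((range (n + 1)).erase v).powersetCard a :=
  memberSubfamily_subset_powersetCard v h.subA

lemma sub_nonMember (h : LargePair n a b l l' t t' A B) (v : ℕ) :
    A.nonMemberSubfamily v ⊆ ((range (n + 1)).erase v).powersetCard (a + 1) :=
  nonMemberSubfamily_subset_powersetCard v h.subA

/-- If many members of `A` avoid `v`, then few members of `B` contain `v`. -/
lemma member_card_le (h : LargePair n a b l l' t t' A B) {v : ℕ} (hv : v < n + 1)
    (hne : (A.nonMemberSubfamily v).Nonempty) {x : ℝ} (hx : (l : ℝ) - 1 ≤ x)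
    (hc : binomPoly x l ≤ (A.nonMemberSubfamily v).card) :
    ((B.memberSubfamily v).card : ℝ) + binomPoly x b ≤ (n.choose b : ℝ) := by
  refine (h.cross.nonMember_member v).card_add_binomPoly_le (h.sub_nonMember v)
    (h.symm.sub_member v) (m := n) (l := l) ?_ (by have := h.hal; omega) h.b_le hne hx hc
  rw [Finset.card_erase_of_mem (Finset.mem_range.2 hv)]; simp

/-- A large degree of `0` in `A` forces a large degree of `0` in `B`. -/
lemma half (h : LargePair n a b l l' t t' A B)
    (hA : (n.choose a : ℝ) - binomPoly t' a < (A.memberSubfamily 0).card) :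
    (n.choose b : ℝ) - binomPoly t b < (B.memberSubfamily 0).card := by
  have hs := cast_card_member_add_nonMember 0 B
  have hB := h.cardB
  unfold sizeBound at hB
  -- Kruskal–Katona needs a nonempty family. In the empty case the strict inequality comes from
  -- `strictB` if t' < l', and from C(t', l') > 0 otherwise.
  rcases (B.nonMemberSubfamily 0).eq_empty_or_nonempty with he | hne
  · rw [he, Finset.card_empty, Nat.cast_zero, add_zero] at hs
    rcases lt_or_ge t' l' with h1 | h1
    · have := h.strictB h1
      unfold sizeBound at this
      have h2 := binomPoly_nonneg h.ht'
      linarith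
    · have h2 : 0 < binomPoly t' l' := binomPoly_pos (by linarith)
      linarith
  · have h3 : ((B.nonMemberSubfamily 0).card : ℝ) < binomPoly t' l' := by
      by_contra hc
      have := h.symm.member_card_le (Nat.succ_pos n) hne h.ht' (not_lt.1 hc)
      linarith
    linarith

lemma card_add_card_le (h : LargePair n a b l l' t t' A B) (hn : a + b + 1 = n) :
    (A.card : ℝ) + B.card ≤ ((n + 1).choose (b + 1) : ℝ) := by
  rcases A.eq_empty_or_nonempty with rfl | hne
  · have := Finset.card_le_card h.subB
    rw [Finset.card_powersetCard, Finset.card_range] at this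
    rw [Finset.card_empty, Nat.cast_zero, zero_add]
    exact_mod_cast this
  · obtain ⟨z, hz, hzA⟩ := exists_binomPoly_eq_of_nonneg (l := b + 1) (by omega)
      (Nat.cast_nonneg A.card)
    have := h.cross.card_add_binomPoly_le h.subA h.subB (Finset.card_range _) (l := b + 1)
      (by omega) le_rfl hne hz hzA.le
    rw [hzA] at this
    linarith

/-- If n = a + b + 1, then l = b and l' = a, so the real terms cancel in the sum of the two size
bounds. The sum is then C(n+1, b+1), which a cross-intersecting pair cannot exceed. -/
lemma add_lt (h : LargePair n a b l l' t t' A B) : a + b + 1 < n := by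
  refine lt_of_le_of_ne h.hab fun hn => ?_
  have h1 := h.card_add_card_le hn
  have e1 : l = b := by have := h.hal; omega
  have e2 : l' = a := by have := h.hbl; omega
  subst e1 e2
  have e3 : n.choose l' = n.choose (l + 1) := by
    rw [← hn, Nat.choose_symm_of_eq_add]; omega
  rw [Nat.choose_succ_succ] at h1
  have hA := h.cardA
  have hB := h.cardB
  have hs := h.strict
  unfold sizeBound at hA hB hs
  rw [e3] at hA hs
  push_cast at h1
  rcases hs with hs | hs <;> linarith

end LargePair

/-- The summands are the bounds for the deletion and the link of a point, so one of these parts must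
be large. -/
lemma sizeBound_pascal {n a l : ℕ} (ha : 1 ≤ a) (hl : 1 ≤ l) (t t' : ℝ) :
    sizeBound (n + 1) a l t t' =
      sizeBound n a (l - 1) (t - 1) (t' - 1) + sizeBound n (a - 1) l (t - 1) (t' - 1) := by
  obtain ⟨a, rfl⟩ : ∃ j, a = j + 1 := ⟨a - 1, by omega⟩
  obtain ⟨l, rfl⟩ : ∃ j, l = j + 1 := ⟨l - 1, by omega⟩
  simp only [sizeBound, Nat.add_sub_cancel]
  rw [Nat.choose_succ_succ', binomPoly_pascal t, binomPoly_pascal t']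
  push_cast
  ring

/-! ### The shifted case, by removing the largest point -/

/-- If many members of `A` containing the largest element `n` contain `0`, then many members of `A`
contain `0`. -/
lemma Shifted.lt_card_member_zero {A : Finset (Finset ℕ)} (hs : Shifted A) {n a : ℕ} (hn : 1 ≤ n)
    (ha : 1 ≤ a) (hA : A ⊆ (range (n + 1)).powersetCard (a + 1)) {t : ℝ} (ht : (a : ℝ) ≤ t)
    (h : ((n - 1).choose (a - 1) : ℝ) - binomPoly (t - 1) (a - 1) <
      ((A.memberSubfamily n).memberSubfamily 0).card) :
    (n.choose a : ℝ) - binomPoly t a < (A.memberSubfamily 0).card := by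
  obtain ⟨a, rfl⟩ : ∃ j, a = j + 1 := ⟨a - 1, by omega⟩
  obtain ⟨m, rfl⟩ : ∃ j, n = j + 1 := ⟨n - 1, by omega⟩
  simp only [Nat.add_sub_cancel] at h
  push_cast at ht
  set V := ((range (m + 1 + 1)).erase 0).erase (m + 1) with hV
  have hVc : V.card = m := by
    rw [hV, Finset.card_erase_of_mem, card_range_erase_zero]
    · rfl
    · simp
  have hsplit := cast_card_member_add_nonMember (m + 1) (A.memberSubfamily 0)
  rw [memberSubfamily_comm A (show (m + 1) ≠ 0 by omega)] at h
  have hA0 := memberSubfamily_subset_powersetCard 0 hA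
  have sG := memberSubfamily_subset_powersetCard (m + 1) hA0
  have sH := nonMemberSubfamily_subset_powersetCard (m + 1) hA0
  set G := (A.memberSubfamily 0).memberSubfamily (m + 1) with hG
  set H := (A.memberSubfamily 0).nonMemberSubfamily (m + 1) with hH
  have cG : ((V.powersetCard a \ G).card : ℝ) = (m.choose a : ℝ) - G.card := by
    rw [Finset.card_sdiff_of_subset sG, Nat.cast_sub (Finset.card_le_card sG),
      Finset.card_powersetCard, hVc]
  have cH : ((V.powersetCard (a + 1) \ H).card : ℝ) = (m.choose (a + 1) : ℝ) - H.card := by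
    rw [Finset.card_sdiff_of_subset sH, Nat.cast_sub (Finset.card_le_card sH),
      Finset.card_powersetCard, hVc]
  -- Shiftedness replaces the largest point by any `k`, so below a set missing from `H` every set is
  -- missing from `G`; Kruskal–Katona then bounds the sets missing from `H`.
  have hsh : (V.powersetCard (a + 1) \ H).shadow ⊆ V.powersetCard a \ G := by
    intro Y hY
    rw [Finset.mem_shadow_iff_insert_mem] at hY
    obtain ⟨k, hk, hY⟩ := hY
    rw [Finset.mem_sdiff, Finset.mem_powersetCard, Finset.card_insert_of_notMem hk,
      Finset.insert_subset_iff] at hY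
    obtain ⟨⟨⟨hkV, hYV⟩, hc⟩, hYH⟩ := hY
    rw [Finset.mem_sdiff, Finset.mem_powersetCard]
    refine ⟨⟨hYV, by omega⟩, fun hYG => hYH ?_⟩
    simp only [hG, hH, Finset.mem_memberSubfamily, Finset.mem_nonMemberSubfamily] at hYG ⊢
    obtain ⟨⟨h1, h2⟩, h3⟩ := hYG
    simp only [hV, Finset.mem_erase, Finset.mem_range] at hkV
    have h4 : 0 ∉ Y := fun h0 => h2 (Finset.mem_insert_of_mem h0)
    have hk0 : k ≠ 0 := hkV.2.1
    refine ⟨⟨?_, ?_⟩, ?_⟩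
    · rw [Finset.insert_comm] at h1 ⊢
      refine hs.insert_mem h1 ?_ (by omega) ?_
      · rw [Finset.mem_insert, not_or]; exact ⟨by omega, h3⟩
      · rw [Finset.mem_insert, not_or]; exact ⟨hk0, hk⟩
    · rw [Finset.mem_insert, not_or]; exact ⟨hk0.symm, h4⟩
    · rw [Finset.mem_insert, not_or]; exact ⟨hkV.1.symm, h3⟩
  have hH' : ((V.powersetCard (a + 1) \ H).card : ℝ) ≤ binomPoly (t - 1) (a + 1) := by
    rcases (V.powersetCard (a + 1) \ H).eq_empty_or_nonempty with he | hne
    · rw [he, Finset.card_empty, Nat.cast_zero]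
      exact binomPoly_nonneg (by push_cast; linarith)
    · by_contra hc
      have h1 := binomPoly_le_card_shadow (l := a) (F := V.powersetCard (a + 1) \ H) (x := t - 1)
        (fun X hX => (Finset.mem_powersetCard.1 (Finset.mem_sdiff.1 hX).1).2) hne
        (by linarith) (not_le.1 hc).le
      have h2 : ((V.powersetCard (a + 1) \ H).shadow.card : ℝ) ≤ (V.powersetCard a \ G).card := by
        exact_mod_cast Finset.card_le_card hsh
      linarith
  rw [Nat.choose_succ_succ', binomPoly_pascal t]
  push_cast
  linarith

/-- In a shifted family, if few members avoid both `0` and the largest element `n`, then few members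
avoid `0`. -/
lemma Shifted.card_nonMember_zero_lt {A : Finset (Finset ℕ)} (hs : Shifted A) {n a l : ℕ}
    (hl : 1 ≤ l) (hn : a + l + 1 = n)
    (hA : A ⊆ (range (n + 1)).powersetCard (a + 1)) {t : ℝ} (ht : (l : ℝ) ≤ t)
    (h : ((A.nonMemberSubfamily n).nonMemberSubfamily 0).Nonempty →
      (((A.nonMemberSubfamily n).nonMemberSubfamily 0).card : ℝ) < binomPoly (t - 1) (l - 1)) :
    ((A.nonMemberSubfamily 0).card : ℝ) < binomPoly t l := by
  obtain ⟨l, rfl⟩ : ∃ j, l = j + 1 := ⟨l - 1, by omega⟩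
  simp only [Nat.add_sub_cancel] at h
  push_cast at ht
  set V := ((range (n + 1)).erase 0).erase n with hV
  have hVc : V.card = a + (l + 1) := by
    rw [hV, Finset.card_erase_of_mem, card_range_erase_zero]
    · omega
    · simp; omega
  have hsplit := cast_card_member_add_nonMember n (A.nonMemberSubfamily 0)
  rw [nonMemberSubfamily_comm A n 0] at h
  have hA0 := nonMemberSubfamily_subset_powersetCard 0 hA
  have sG := memberSubfamily_subset_powersetCard n hA0
  have sH := nonMemberSubfamily_subset_powersetCard n hA0
  set G := (A.nonMemberSubfamily 0).memberSubfamily n with hG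
  set H := (A.nonMemberSubfamily 0).nonMemberSubfamily n with hH
  have sG' : ∀ X ∈ G, X ⊆ V := fun X hX => (Finset.mem_powersetCard.1 (sG hX)).1
  have sH' : ∀ X ∈ H, X ⊆ V := fun X hX => (Finset.mem_powersetCard.1 (sH hX)).1
  have cG := card_image_sdiff_left sG'
  have cH := card_image_sdiff_left sH'
  have hGs : ((G.image (V \ ·) : Finset (Finset ℕ)) : Set (Finset ℕ)).Sized (l + 1) := by
    intro Z hZ
    rw [Finset.mem_coe, Finset.mem_image] at hZ
    obtain ⟨X, hX, rfl⟩ := hZ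
    have hX' := Finset.mem_powersetCard.1 (sG hX)
    rw [Finset.card_sdiff_of_subset hX'.1, hVc, hX'.2]
    omega
  -- Replacing the largest point by `k` adds `k` to a set of `G` and gives a set of `H`; on
  -- complements this is removal of `k`.
  have hsh : (G.image (V \ ·)).shadow ⊆ H.image (V \ ·) := by
    intro Y hY
    rw [Finset.mem_shadow_iff_insert_mem] at hY
    obtain ⟨k, hk, hY⟩ := hY
    rw [Finset.mem_image] at hY ⊢
    obtain ⟨X, hX, hXY⟩ := hY
    have hkV : k ∈ V \ X := by rw [hXY]; exact Finset.mem_insert_self _ _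
    rw [Finset.mem_sdiff] at hkV
    refine ⟨insert k X, ?_, ?_⟩
    · simp only [hG, hH, Finset.mem_memberSubfamily, Finset.mem_nonMemberSubfamily] at hX ⊢
      obtain ⟨⟨h1, h2⟩, h3⟩ := hX
      have hkV' := hkV.1
      simp only [hV, Finset.mem_erase, Finset.mem_range] at hkV'
      refine ⟨⟨hs.insert_mem h1 h3 (by omega) hkV.2, ?_⟩, ?_⟩
      · rw [Finset.mem_insert, not_or]
        exact ⟨fun e => hkV'.2.1 e.symm, fun h0 => h2 (Finset.mem_insert_of_mem h0)⟩
      · rw [Finset.mem_insert, not_or]; exact ⟨fun e => hkV'.1 e.symm, h3⟩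
    · have : V \ insert k X = (V \ X).erase k := by
        ext i; simp only [Finset.mem_sdiff, Finset.mem_insert, Finset.mem_erase]; tauto
      rw [this, hXY, Finset.erase_insert hk]
  have hcard : (H.Nonempty ∨ ¬ G.Nonempty) := by
    by_contra hc
    push Not at hc
    have h1 := shadow_nonempty_of_sized hGs (hc.2.image _)
    obtain ⟨Y, hY⟩ := h1
    have := hsh hY
    rw [hc.1] at this
    simp at this
  have hG' : (G.card : ℝ) ≤ binomPoly (t - 1) (l + 1) := by
    rcases G.eq_empty_or_nonempty with he | hne
    · rw [he, Finset.card_empty, Nat.cast_zero]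
      exact binomPoly_nonneg (by push_cast; linarith)
    · by_contra hc
      have h1 := binomPoly_le_card_shadow hGs (hne.image _) (x := t - 1) (by linarith)
        (by rw [cG]; exact (not_le.1 hc).le)
      have h2 : ((G.image (V \ ·)).shadow.card : ℝ) ≤ H.card := by
        rw [← cH]; exact_mod_cast Finset.card_le_card hsh
      have h3 := h (hcard.resolve_right (not_not.2 hne))
      linarith
  rw [binomPoly_pascal t]
  rcases H.eq_empty_or_nonempty with he | hne
  · rw [he, Finset.card_empty, Nat.cast_zero] at hsplit
    have : 0 < binomPoly (t - 1) l := binomPoly_pos (by linarith)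
    linarith
  · have := h hne
    linarith

namespace LargePair

variable {n a b l l' : ℕ} {t t' : ℝ} {A B : Finset (Finset ℕ)}

/-- One of the two families obtained by removing the largest element is large again. -/
lemma exists_large_part (h : LargePair (n + 1) a b l l' t t' A B) (hs : Shifted A)
    (hred : l ≤ t ∨ a = 1) :
    (((n + 1).choose a : ℝ) - binomPoly t' a < (A.memberSubfamily 0).card) ∨
    ∃ (c k : ℕ) (C : Finset (Finset ℕ)), c + k + 1 = n ∧ 1 ≤ c ∧ c ≤ a ∧
      C ⊆ (range (n + 1)).powersetCard (c + 1) ∧ Shifted C ∧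
      sizeBound n c k (t - 1) (t' - 1) ≤ C.card ∧
      (sizeBound (n + 1) a l t t' < A.card → sizeBound n c k (t - 1) (t' - 1) < C.card) ∧
      (t - 1 < k → sizeBound n c k (t - 1) (t' - 1) < C.card) ∧ (k : ℝ) - 1 ≤ t - 1 ∧
      ((C = A.memberSubfamily (n + 1) ∧ a = c + 1) ∨
        (C = A.nonMemberSubfamily (n + 1) ∧ a = c ∧ l = k + 1 ∧
          (a = 1 → A.memberSubfamily (n + 1) = ∅))) := by
  have hl1 : 2 ≤ l := by have := h.add_lt; have := h.hal; have := h.hb; omega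
  have hlt : a ≤ l' := h.a_le
  have hall : a + 1 ≤ l' := by have := h.add_lt; have := h.hbl; omega
  have hat : (a : ℝ) ≤ t' := by
    have : (a : ℝ) + 1 ≤ l' := by exact_mod_cast hall
    linarith [h.ht']
  have ha := h.ha
  have hsub : ∀ X ∈ A, X ⊆ range (n + 1 + 1) := fun X hX =>
    (Finset.mem_powersetCard.1 (h.subA hX)).1
  have hcard := cast_card_member_add_nonMember (n + 1) A
  have her : (range (n + 1 + 1)).erase (n + 1) = range (n + 1) := by
    rw [Finset.range_add_one, Finset.erase_insert (by simp)]
  have hcA := h.cardA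
  have hal := h.hal
  have hp := sizeBound_pascal (n := n) ha (show 1 ≤ l by omega) t t'
  have sm := h.sub_member (n + 1)
  have snm := h.sub_nonMember (n + 1)
  rw [her] at sm snm
  have hlr : ((l - 1 : ℕ) : ℝ) = l - 1 := by
    rw [Nat.cast_sub (by omega)]; simp
  rcases Nat.lt_or_ge 1 a with ha2 | ha1
  · right
    have hlt' : (l : ℝ) ≤ t := hred.resolve_right (by omega)
    rcases lt_or_ge (sizeBound n (a - 1) l (t - 1) (t' - 1))
      ((A.memberSubfamily (n + 1)).card : ℝ) with h1 | h1
    · refine ⟨a - 1, l, A.memberSubfamily (n + 1), by omega, by omega, by omega, ?_,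
        hs.memberSubfamily hsub, h1.le, fun _ => h1, fun _ => h1, by linarith,
        Or.inl ⟨rfl, by omega⟩⟩
      rwa [Nat.sub_add_cancel ha]
    · refine ⟨a, l - 1, A.nonMemberSubfamily (n + 1), by omega, ha, le_rfl, snm,
        hs.nonMemberSubfamily hsub, by linarith, fun _ => by linarith, fun h2 => ?_, ?_,
        Or.inr ⟨rfl, rfl, by omega, fun _ => by omega⟩⟩
      · rw [hlr] at h2; linarith
      · rw [hlr]; linarith
  · have ha' : a = 1 := by omega
    rcases (A.memberSubfamily (n + 1)).eq_empty_or_nonempty with he | ⟨X, hX⟩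
    · right
      rw [he, Finset.card_empty, Nat.cast_zero, zero_add] at hcard
      -- For a = 1 the constraints on `t` force t = l - 1, so an empty link costs nothing.
      have hz : sizeBound n (a - 1) l (t - 1) (t' - 1) = 0 := by
        have e1 : t = l - 1 := by
          have e2 := h.htn
          have e3 := h.ht
          have : ((a + l + 1 : ℕ) : ℝ) = ((n + 1 : ℕ) : ℝ) := by rw [hal]
          rw [ha'] at this
          push_cast at this e2
          linarith
        have e2 : t - 1 - 1 + 1 = ((l - 2 : ℕ) : ℝ) := by
          rw [Nat.cast_sub hl1, e1]; push_cast; ring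
        have e3 : t - 1 = ((l - 2 : ℕ) : ℝ) := by linarith
        rw [sizeBound, ha', Nat.sub_self, binomPoly_zero, e3, binomPoly_natCast,
          Nat.choose_eq_zero_of_lt (show l - 2 < l by omega)]
        simp
      refine ⟨a, l - 1, A.nonMemberSubfamily (n + 1), by omega, ha, le_rfl, snm,
        hs.nonMemberSubfamily hsub, by linarith, fun _ => by linarith, fun h2 => ?_, ?_,
        Or.inr ⟨rfl, rfl, by omega, fun _ => he⟩⟩
      · rw [hlr] at h2
        have := h.strictA (by linarith)
        linarith
      · rw [hlr]; linarith [h.ht]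
    · left
      -- For a = 1 the remaining goal is that some member contains both 0 and the largest point;
      -- shifting the other element of a pair through the largest point to 0 gives it.
      refine hs.lt_card_member_zero (by omega) ha h.subA hat ?_
      have hX' := Finset.mem_powersetCard.1 (sm hX)
      rw [ha'] at hX' ⊢
      rw [Nat.sub_self, binomPoly_zero, Nat.choose_zero_right, Nat.cast_one, sub_self, Nat.cast_pos,
        Finset.card_pos]
      obtain ⟨k, rfl⟩ := Finset.card_eq_one.1 hX'.2
      have hk : k < n + 1 := by simpa using hX'.1
      rw [Finset.mem_memberSubfamily] at hX
      refine ⟨∅, ?_⟩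
      rw [Finset.mem_memberSubfamily, Finset.mem_memberSubfamily]
      refine ⟨⟨?_, by simp⟩, by simp⟩
      rcases Nat.eq_zero_or_pos k with rfl | hk0
      · exact hX.1
      · have := hX.1
        rw [Finset.pair_comm] at this
        have := hs.insert_mem this (by simp; omega) hk0 (by simp)
        rw [Finset.pair_comm] at this
        exact this

/-- The subfamilies obtained by removing the largest element are cross-intersecting. -/
lemma cross_parts (h : LargePair (n + 1) a b l l' t t' A B) (hs : Shifted A)
    {C D : Finset (Finset ℕ)}
    (hC : C = A.memberSubfamily (n + 1) ∨ C = A.nonMemberSubfamily (n + 1))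
    (hD : D = B.memberSubfamily (n + 1) ∨ D = B.nonMemberSubfamily (n + 1)) : CrossMeet C D := by
  rcases hC with rfl | rfl <;> rcases hD with rfl | rfl
  · intro X hX Y hY hd
    have hX' := Finset.mem_powersetCard.1 (h.sub_member (n + 1) hX)
    have hY' := Finset.mem_powersetCard.1 (h.symm.sub_member (n + 1) hY)
    rw [Finset.mem_memberSubfamily] at hX hY
    have hc : (X ∪ Y).card < (range (n + 1)).card := by
      have := Finset.card_union_le X Y
      rw [Finset.card_range]
      have := h.add_lt
      omega
    -- Two members might meet only in the largest point; moving it in one of them to an unused `k`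
    -- would make them disjoint.
    obtain ⟨k, hk, hkXY⟩ := Finset.exists_mem_notMem_of_card_lt_card hc
    rw [Finset.mem_union, not_or] at hkXY
    have hk' := Finset.mem_range.1 hk
    have h1 := hs.insert_mem hX.1 hX.2 hk' hkXY.1
    refine h.cross _ h1 _ hY.1 ?_
    rw [Finset.disjoint_insert_left, Finset.disjoint_insert_right, Finset.mem_insert, not_or]
    exact ⟨⟨by omega, hkXY.2⟩, hX.2, hd⟩
  · exact h.cross.member_nonMember _
  · exact h.cross.nonMember_member _
  · exact h.cross.nonMember_nonMember _

/-- The induction step when the parameters are in the range where the binomial coefficients are not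
truncated. -/
lemma half_step (h : LargePair (n + 1) a b l l' t t' A B) (hsA : Shifted A) (hsB : Shifted B)
    (hA : l ≤ t ∨ a = 1) (hB : l' ≤ t' ∨ b = 1)
    (ih : ∀ (a b l l' : ℕ) (t t' : ℝ) (A B : Finset (Finset ℕ)), LargePair n a b l l' t t' A B →
      Shifted A → Shifted B →
      (n.choose a : ℝ) - binomPoly t' a < (A.memberSubfamily 0).card ∧
      (n.choose b : ℝ) - binomPoly t b < (B.memberSubfamily 0).card) :
    ((n + 1).choose a : ℝ) - binomPoly t' a < (A.memberSubfamily 0).card := by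
  have hat : (a : ℝ) ≤ t' := by
    have : a + 1 ≤ l' := by have := h.add_lt; have := h.hbl; omega
    have : (a : ℝ) + 1 ≤ l' := by exact_mod_cast this
    linarith [h.ht']
  have hbt : (b : ℝ) ≤ t := by
    have : b + 1 ≤ l := by have := h.add_lt; have := h.hal; omega
    have : (b : ℝ) + 1 ≤ l := by exact_mod_cast this
    linarith [h.ht]
  have hab := h.add_lt
  rcases h.exists_large_part hsA hA with h1 | ⟨c, k, C, hck, hc1, hca, hCs, hCsh, hCc, hCst, hCst',
    hkt, hC⟩
  · exact h1
  rcases h.symm.exists_large_part hsB hB with h1 | ⟨d, k', D, hdk, hd1, hdb, hDs, hDsh, hDc, hDst,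
    hDst', hkt', hD⟩
  · exact h.symm.half h1
  have hcross : CrossMeet C D := h.cross_parts hsA (hC.imp And.left And.left)
    (hD.imp And.left And.left)
  have hL : LargePair n c d k k' (t - 1) (t' - 1) C D :=
    { hal := hck, hbl := hdk, hab := by omega, ha := hc1, hb := hd1, subA := hCs, subB := hDs
      cross := hcross, ht := hkt, ht' := hkt'
      htn := by have := h.htn; push_cast at this; linarith
      htn' := by have := h.htn'; push_cast at this; linarith
      cardA := hCc, cardB := hDc, strict := h.strict.imp hCst hDst, strictA := hCst'
      strictB := hDst' }
  obtain ⟨k1, k2⟩ := ih _ _ _ _ _ _ _ _ hL hCsh hDsh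
  rcases hC with ⟨rfl, rfl⟩ | ⟨rfl, rfl, rfl, hC1⟩
  · exact hsA.lt_card_member_zero (by omega) h.ha h.subA hat (by simpa using k1)
  rcases hD with ⟨rfl, rfl⟩ | ⟨rfl, rfl, rfl, hD1⟩
  · exact h.symm.half (hsB.lt_card_member_zero (by omega) h.hb h.subB hbt (by simpa using k2))
  -- With an empty link the family equals its deletion, and for 2-element members the bound is
  -- unchanged when n and the parameter both drop by one.
  have key : ∀ {E : Finset (Finset ℕ)} {s : ℝ}, E.memberSubfamily (n + 1) = ∅ →
      (n.choose 1 : ℝ) - binomPoly (s - 1) 1 <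
        ((E.nonMemberSubfamily (n + 1)).memberSubfamily 0).card →
      ((n + 1).choose 1 : ℝ) - binomPoly s 1 < (E.memberSubfamily 0).card := by
    intro E s hE h1
    have h2 : E.nonMemberSubfamily (n + 1) = E := by
      have h3 := Finset.card_memberSubfamily_add_card_nonMemberSubfamily (n + 1) E
      rw [hE, Finset.card_empty, zero_add] at h3
      exact Finset.eq_of_subset_of_card_le (Finset.filter_subset _ _) h3.ge
    rw [h2] at h1
    rw [binomPoly_one, Nat.choose_one_right] at h1 ⊢
    push_cast
    linarith
  by_cases ha1 : a = 1
  · subst ha1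
    exact key (hC1 rfl) k1
  by_cases hb1 : b = 1
  · subst hb1
    exact h.symm.half (key (hD1 rfl) k2)
  have hlt := hA.resolve_right ha1
  -- Both parts are deletions. The large degree of 0 in `B`'s part forces few sets in `A`'s part to
  -- avoid 0, and shiftedness lifts this to `A`.
  have hnm := hsA.card_nonMember_zero_lt (l := k + 1) (by omega) h.hal h.subA hlt (by
    intro hne
    by_contra hc
    simp only [Nat.add_sub_cancel] at hc
    have := hL.member_card_le (Nat.succ_pos n) hne (by push_cast at hlt; linarith) (not_lt.1 hc)
    linarith)
  have hcA := h.cardA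
  have := cast_card_member_add_nonMember 0 A
  unfold sizeBound at hcA
  linarith

/-- Raising the parameter `t` to `l`. -/
lemma exists_reduced (h : LargePair n a b l l' t t' A B) (ht : t < l) (ha : 2 ≤ a) :
    ∃ s, t' ≤ s ∧ LargePair n a b l l' l s A B := by
  obtain ⟨N, rfl⟩ : ∃ N, n = N + 3 := ⟨n - 3, by have := h.hab; have := h.hb; omega⟩
  have hb := h.hb
  have hal := h.hal
  have hbl := h.hbl
  have hal' := h.a_le
  have htN : t ≤ N := by have := h.htn; push_cast at this; linarith
  have htN' : t' ≤ N := by have := h.htn'; push_cast at this; linarith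
  have hlN : (l : ℝ) ≤ N := by exact_mod_cast (by omega : l ≤ N)
  have hat' : (a : ℝ) - 1 ≤ t' := by
    have : (a : ℝ) ≤ l' := by exact_mod_cast hal'
    linarith [h.ht']
  have e1 : N.choose (l - 1) = N.choose (a - 1) := by
    rw [Nat.choose_symm_of_eq_add]; omega
  have e2 : N.choose (l' - 1) = N.choose (b - 1) := by
    rw [Nat.choose_symm_of_eq_add]; omega
  have c1 : (0 : ℝ) < N.choose (a - 1) := by exact_mod_cast Nat.choose_pos (by omega)
  have sl := binomPoly_chord (N := N) hb h.b_le h.ht ht.le htN (by linarith)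
  rw [e1, binomPoly_self] at sl
  have sl' : ∀ s, t' ≤ s → s ≤ N → _ := fun s hs hsN =>
    binomPoly_chord (N := N) h.ha hal' h.ht' hs htN' (by linarith)
  rw [e2] at sl'
  have hsA := h.strictA ht
  have hcB := h.cardB
  unfold sizeBound at hsA hcB
  have hP := binomPoly_nonneg h.ht
  -- Raising `t` to `l` raises `A`'s bound by 1 - C(t, l). The parameter `s` is chosen to cancel
  -- this, and the reciprocal slopes keep `B`'s bound from growing. If that `s` would exceed n - 3,
  -- then s = n - 3 is used.
  rcases le_or_gt (binomPoly t' a + (1 - binomPoly t l)) (binomPoly N a) with hc | hc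
  · have h1 : binomPoly t l ≤ 1 := by rw [← binomPoly_self l]; exact binomPoly_mono h.ht ht.le
    obtain ⟨s, hs, hsa⟩ := exists_binomPoly_eq h.ha hat'
      (show binomPoly t' a ≤ binomPoly t' a + (1 - binomPoly t l) by linarith)
    have hsN : s ≤ N := le_of_binomPoly_le h.ha (by linarith) (by rw [hsa]; exact hc)
    have sl2 := sl' s hs hsN
    rw [hsa] at sl2
    have d1 : binomPoly s l' - binomPoly t' l' ≤ binomPoly l b - binomPoly t b := by
      apply le_of_mul_le_mul_left _ c1
      linarith
    refine ⟨s, hs, { h with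
      ht := by linarith
      ht' := by linarith [h.ht']
      htn := by push_cast; linarith
      htn' := by push_cast; linarith
      cardA := ?_
      cardB := ?_
      strict := Or.inl ?_
      strictA := fun hl => absurd hl (lt_irrefl _)
      strictB := fun hl => ?_ }⟩
    · unfold sizeBound; rw [binomPoly_self]; linarith
    · unfold sizeBound; linarith
    · unfold sizeBound; rw [binomPoly_self]; linarith
    · have := h.strictB (by linarith)
      unfold sizeBound at this ⊢; linarith
  · have sl2 := sl' N htN' le_rfl
    have d1 : binomPoly N l' - binomPoly t' l' < binomPoly l b - binomPoly t b := by
      have c2 : (0 : ℝ) < N.choose (b - 1) := by exact_mod_cast Nat.choose_pos (by omega)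
      apply lt_of_mul_lt_mul_left _ c1.le
      have := mul_lt_mul_of_pos_left hc c2
      linarith
    have hBs : sizeBound (N + 3) b l' N l < B.card := by unfold sizeBound; linarith
    have hmono : binomPoly t' a ≤ binomPoly N a := binomPoly_mono hat' htN'
    refine ⟨N, htN', { h with
      ht := by linarith
      ht' := by linarith [h.ht']
      htn := by push_cast; linarith
      htn' := by push_cast; linarith
      cardA := ?_
      cardB := hBs.le
      strict := Or.inr hBs
      strictA := fun hl => absurd hl (lt_irrefl _)
      strictB := fun _ => hBs }⟩
    unfold sizeBound
    rw [binomPoly_self, binomPoly_natCast]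
    rw [binomPoly_natCast] at hmono
    -- Both sides are integers, so strictness yields the extra 1 = C(l, l) in `A`'s new bound.
    have h3 : ((N + 3).choose a : ℝ) < A.card + (N.choose a : ℝ) := by linarith
    have h4 : (N + 3).choose a + 1 ≤ A.card + N.choose a := by exact_mod_cast h3
    have h5 : ((N + 3).choose a : ℝ) + 1 ≤ A.card + (N.choose a : ℝ) := by exact_mod_cast h4
    linarith

/-- The bound obtained after raising the parameters gives the bound for the original ones. -/
lemma half_of_reduced (h : LargePair n a b l l' t t' A B)
    (hB : (n.choose b : ℝ) - binomPoly l b < (B.memberSubfamily 0).card) (ht : t < l) :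
    (n.choose a : ℝ) - binomPoly t' a < (A.memberSubfamily 0).card := by
  -- One member avoiding 0 already amounts to C(l, l), which Kruskal–Katona excludes.
  have he : A.nonMemberSubfamily 0 = ∅ := by
    by_contra hne
    have hne := Finset.nonempty_iff_ne_empty.2 hne
    have := h.member_card_le (Nat.succ_pos n) hne (x := l) (by linarith)
      (by rw [binomPoly_self]; exact_mod_cast Finset.card_pos.2 hne)
    linarith
  have hs := cast_card_member_add_nonMember 0 A
  rw [he, Finset.card_empty, Nat.cast_zero, add_zero] at hs
  have h1 := h.strictA ht
  have h2 := binomPoly_nonneg h.ht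
  unfold sizeBound at h1
  linarith

/-- In large shifted cross-intersecting families the element `0` has large degree. -/
theorem shifted_bounds : ∀ (n a b l l' : ℕ) (t t' : ℝ) (A B : Finset (Finset ℕ)),
    LargePair n a b l l' t t' A B → Shifted A → Shifted B →
    (n.choose a : ℝ) - binomPoly t' a < (A.memberSubfamily 0).card ∧
    (n.choose b : ℝ) - binomPoly t b < (B.memberSubfamily 0).card := by
  intro n
  induction n with
  | zero => intro a b l l' t t' A B h; exact absurd h.hab (by omega)
  | succ n ih =>
    have main : ∀ (a b l l' : ℕ) (t t' : ℝ) (A B : Finset (Finset ℕ)),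
        LargePair (n + 1) a b l l' t t' A B → Shifted A → Shifted B →
        (l ≤ t ∨ a = 1) → (l' ≤ t' ∨ b = 1) →
        ((n + 1).choose a : ℝ) - binomPoly t' a < (A.memberSubfamily 0).card ∧
        ((n + 1).choose b : ℝ) - binomPoly t b < (B.memberSubfamily 0).card := by
      intro a b l l' t t' A B h hA hB h1 h2
      have h3 := h.half_step hA hB h1 h2 ih
      exact ⟨h3, h.half h3⟩
    have main2 : ∀ (a b l l' : ℕ) (t t' : ℝ) (A B : Finset (Finset ℕ)),
        LargePair (n + 1) a b l l' t t' A B → Shifted A → Shifted B →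
        (l ≤ t ∨ a = 1) →
        ((n + 1).choose a : ℝ) - binomPoly t' a < (A.memberSubfamily 0).card ∧
        ((n + 1).choose b : ℝ) - binomPoly t b < (B.memberSubfamily 0).card := by
      intro a b l l' t t' A B h hA hB h1
      by_cases h2 : l' ≤ t' ∨ b = 1
      · exact main a b l l' t t' A B h hA hB h1 h2
      · rw [not_or, not_le] at h2
        obtain ⟨s, hs, h'⟩ := h.symm.exists_reduced h2.1 (by have := h.hb; omega)
        -- Repairing `t'` only increases `t`, so the condition l ≤ t survives.
        have h3 := main _ _ _ _ _ _ _ _ h'.symm hA hB (h1.imp_left fun h1 => h1.trans hs)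
          (Or.inl le_rfl)
        have h4 := h.symm.half_of_reduced h3.1 h2.1
        exact ⟨h.symm.half h4, h4⟩
    intro a b l l' t t' A B h hA hB
    by_cases h2 : l ≤ t ∨ a = 1
    · exact main2 a b l l' t t' A B h hA hB h2
    · rw [not_or, not_le] at h2
      obtain ⟨s, hs, h'⟩ := h.exists_reduced h2.1 (by have := h.ha; omega)
      have h3 := main2 _ _ _ _ _ _ _ _ h' hA hB (Or.inl le_rfl)
      have h4 := h.half_of_reduced h3.2 h2.1
      exact ⟨h4, h.half h4⟩

end LargePair

/-! ### Inequalities for traces on two points -/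

/-- Numerical data of a pair of cross-intersecting families traced on two points: `p`, `q` and `r`,
`s` count the members of the two families containing exactly one of the two points, `e` and `f` those
containing none, and `δ`, `ε` the missing ones containing both. -/
structure TraceData (X Y c d ξ η : ℝ) (κ μ : ℝ → ℝ) (p q r s e f δ ε : ℝ) : Prop where
  hκ : ConcaveOn ℝ (Set.Ici 0) κ
  hμ : ConcaveOn ℝ (Set.Ici 0) μ
  mκ : MonotoneOn κ (Set.Ici 0)
  mμ : MonotoneOn μ (Set.Ici 0)
  hc : 0 < c
  hd : 0 < d
  κX : κ X - κ (X - c) = d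
  μY : μ Y - μ (Y - d) = c
  hξ : 0 < ξ
  hη : 0 < η
  hξX : ξ ≤ X - c
  hηY : η ≤ Y - d
  ps : 0 < s → p ≤ X + μ Y - μ s
  sp : 0 < p → s ≤ Y + κ X - κ p
  qr : 0 < r → q ≤ X + μ Y - μ r
  rq : 0 < q → r ≤ Y + κ X - κ q
  he0 : 0 ≤ e
  hf0 : 0 ≤ f
  he : e ≤ c
  hf : f ≤ d
  hδ : c * f ≤ d * δ
  hε : d * e ≤ c * ε
  hA : X + μ Y - μ η + ξ ≤ p + q + e - δ
  hB : Y + κ X - κ ξ + η ≤ r + s + f - ε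
  strict : X + μ Y - μ η + ξ < p + q + e - δ ∨ Y + κ X - κ ξ + η < r + s + f - ε

namespace TraceData

variable {X Y c d ξ η : ℝ} {κ μ : ℝ → ℝ} {p q r s e f δ ε : ℝ}

lemma swap (h : TraceData X Y c d ξ η κ μ p q r s e f δ ε) :
    TraceData X Y c d ξ η κ μ q p s r e f δ ε :=
  { h with
    ps := h.qr
    sp := h.rq
    qr := h.ps
    rq := h.sp
    hA := by linarith [h.hA]
    hB := by linarith [h.hB]
    strict := h.strict.imp (fun h => by linarith) (fun h => by linarith) }

lemma dual (h : TraceData X Y c d ξ η κ μ p q r s e f δ ε) :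
    TraceData Y X d c η ξ μ κ r s p q f e ε δ where
  hκ := h.hμ
  hμ := h.hκ
  mκ := h.mμ
  mμ := h.mκ
  hc := h.hd
  hd := h.hc
  κX := h.μY
  μY := h.κX
  hξ := h.hη
  hη := h.hξ
  hξX := h.hηY
  hηY := h.hξX
  ps := h.rq
  sp := h.qr
  qr := h.sp
  rq := h.ps
  he0 := h.hf0
  hf0 := h.he0
  he := h.hf
  hf := h.he
  hδ := h.hε
  hε := h.hδ
  hA := h.hB
  hB := h.hA
  strict := h.strict.symm

/-- The reference chord of `κ` over [X - c, X] has slope d/c; that of `μ` over [Y - d, Y] has slope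
c/d. Hence the weights `d` and `c` throughout. -/
lemma slope_κ (h : TraceData X Y c d ξ η κ μ p q r s e f δ ε) {w x : ℝ} (hw : 0 ≤ w) (hwx : w ≤ x)
    (hwX : w ≤ X - c) (hxX : x ≤ X) : d * (x - w) ≤ c * (κ x - κ w) := by
  have := h.hκ.chord_le hw hwx hwX hxX (by linarith [h.hc])
  rw [h.κX] at this
  linarith

lemma slope_κ_top (h : TraceData X Y c d ξ η κ μ p q r s e f δ ε) {w : ℝ} (hw : X - c ≤ w)
    (hwX : w ≤ X) : c * (κ X - κ w) ≤ d * (X - w) := by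
  rcases hwX.eq_or_lt with rfl | hlt
  · simp
  have := h.hκ.chord_le (w := X - c) (by linarith [h.hξX, h.hξ]) (by linarith [h.hc]) hw le_rfl hlt
  rw [h.κX] at this
  linarith

lemma s_le_of_p_gt (h : TraceData X Y c d ξ η κ μ p q r s e f δ ε) (hp : X + c < p) :
    s ≤ Y - d := by
  by_contra hs
  push Not at hs
  have h0 : 0 < Y - d := lt_of_lt_of_le h.hη h.hηY
  have h1 := h.ps (by linarith)
  have h2 := h.mμ (Set.mem_Ici.2 h0.le) (Set.mem_Ici.2 (h0.le.trans hs.le)) hs.le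
  linarith [h.μY]

lemma tradeoff_of_gt (h : TraceData X Y c d ξ η κ μ p q r s e f δ ε) (hp : p ≤ X + c) (hX : X < p) :
    d * (p - X) + c * (s - Y) ≤ 0 := by
  have h0 : 0 < Y - d := lt_of_lt_of_le h.hη h.hηY
  have hd := h.hd
  have hc := h.hc
  have hs : s < Y := by
    by_contra hs
    push Not at hs
    have h1 := h.ps (by linarith)
    have h2 := h.mμ (Set.mem_Ici.2 (by linarith : (0 : ℝ) ≤ Y))
      (Set.mem_Ici.2 (by linarith : (0 : ℝ) ≤ s)) hs
    linarith
  rcases le_or_gt (Y - d) s with h1 | h1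
  · have h2 := h.ps (by linarith)
    have h3 := h.dual.slope_κ_top h1 hs.le
    have h4 := mul_le_mul_of_nonneg_left (show p - X ≤ μ Y - μ s by linarith) hd.le
    linarith
  · have h2 := mul_lt_mul_of_pos_left h1 hc
    have h3 := mul_le_mul_of_nonneg_left hp hd.le
    linarith

lemma tradeoff (h : TraceData X Y c d ξ η κ μ p q r s e f δ ε) (hp : p ≤ X + c) (hs : s ≤ Y + d) :
    d * (p - X) + c * (s - Y) ≤ 0 := by
  rcases lt_or_ge X p with h1 | h1
  · exact h.tradeoff_of_gt hp h1
  rcases lt_or_ge Y s with h2 | h2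
  · have := h.dual.swap.tradeoff_of_gt hs h2
    linarith
  · have h3 := mul_nonneg h.hd.le (sub_nonneg.2 h1)
    have h4 := mul_nonneg h.hc.le (sub_nonneg.2 h2)
    linarith

/-- With weights `d` and `c` the size bounds add up to at least 2dX + 2cY, and the trade-offs allow
at most that; strictness decides. -/
lemma not_all_le (h : TraceData X Y c d ξ η κ μ p q r s e f δ ε) (hp : p ≤ X + c)
    (hq : q ≤ X + c) (hr : r ≤ Y + d) (hs : s ≤ Y + d) : False := by
  have h1 := h.tradeoff hp hs
  have h2 := h.swap.tradeoff hq hr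
  have hc := h.hc
  have hd := h.hd
  have h3 := h.slope_κ h.hξ.le (by linarith [h.hξX]) h.hξX le_rfl
  have h4 := h.dual.slope_κ h.hη.le (by linarith [h.hηY]) h.hηY le_rfl
  have h5 := h.hδ
  have h6 := h.hε
  have hA := mul_le_mul_of_nonneg_left h.hA hd.le
  have hB := mul_le_mul_of_nonneg_left h.hB hc.le
  rcases h.strict with hs | hs
  · have := mul_lt_mul_of_pos_left hs hd
    linarith
  · have := mul_lt_mul_of_pos_left hs hc
    linarith

/-- A very large `p` makes `s` small. If q + e were also above `X`, the bound for `B` would force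
`s` (or r + s - Y) up to at least `η`, and concavity of `μ` would then make the first family too
small. -/
lemma small_of_p_gt (h : TraceData X Y c d ξ η κ μ p q r s e f δ ε) (hp : X + c < p) :
    q + e ≤ X ∧ s + f ≤ Y := by
  have hs := h.s_le_of_p_gt hp
  have hc := h.hc
  have hd := h.hd
  have he := h.he
  have hf := h.hf
  have hξ := h.hξ
  have hη := h.hη
  have hξX := h.hξX
  have hηY := h.hηY
  have hδ := h.hδ
  have hε := h.hε
  refine ⟨?_, by linarith⟩
  by_contra hqe
  push Not at hqe
  have sκ := h.slope_κ hξ.le (by linarith) hξX le_rfl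
  have hA := mul_le_mul_of_nonneg_left h.hA hd.le
  have hB := mul_le_mul_of_nonneg_left h.hB hc.le
  rcases le_or_gt q (X + c) with hq | hq
  · have hq0 : X - c ≤ q := by linarith
    have hr : r ≤ Y + d := by
      have h1 := h.rq (by linarith)
      have h2 := h.mκ (Set.mem_Ici.2 (by linarith : (0 : ℝ) ≤ X - c))
        (Set.mem_Ici.2 (by linarith : (0 : ℝ) ≤ q)) hq0
      linarith [h.κX]
    have h1 := h.swap.tradeoff hq hr
    have h2 : d * (q + e - ξ) ≤ c * (s + f - η) := by linarith
    have h3 : η ≤ s := by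
      have : c * d ≤ c * (s + f - η) := by
        refine le_trans ?_ h2
        rw [mul_comm c d]
        exact mul_le_mul_of_nonneg_left (by linarith) hd.le
      have := le_of_mul_le_mul_left this hc
      linarith
    have h4 := mul_le_mul_of_nonneg_left (h.ps (by linarith)) hd.le
    have h5 := h.dual.slope_κ hη.le h3 hηY (by linarith)
    rcases h.strict with h6 | h6
    · have := mul_lt_mul_of_pos_left h6 hd
      linarith
    · have := mul_lt_mul_of_pos_left h6 hc
      linarith
  · have hr := h.swap.s_le_of_p_gt hq
    -- Spreading `r` and `s` to `z` and `Y` keeps their sum and, by concavity, does not increase the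
    -- sum of the values of `μ`.
    obtain ⟨z, hz⟩ : ∃ z, z = r + s - Y := ⟨_, rfl⟩
    have h2 : d * (X - ξ + e) ≤ c * (z + f - η) := by rw [hz]; linarith
    have he0 := mul_nonneg hd.le h.he0
    have h3 : η ≤ z := by
      have : c * d ≤ c * (z + f - η) := by
        refine le_trans ?_ h2
        rw [mul_comm c d]
        exact mul_le_mul_of_nonneg_left (by linarith [h.he0]) hd.le
      have := le_of_mul_le_mul_left this hc
      linarith
    have h4 := h.hμ.chord_le (w := z) (x := r) (y := s) (z := Y) (by linarith) (by linarith)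
      (by linarith) (by linarith) (by linarith)
    have h5 : μ Y - μ s ≤ μ r - μ z := by
      have e1 : r - z = Y - s := by linarith
      rw [e1] at h4
      exact le_of_mul_le_mul_right h4 (by linarith)
    have h6 := h.ps (by linarith)
    have h7 := h.qr (by linarith)
    have h8 := h.dual.slope_κ hη.le h3 hηY (by linarith)
    have h9 := mul_le_mul_of_nonneg_left (show p + q ≤ 2 * X + μ Y - μ z by linarith) hd.le
    have h10 : c * z = c * (r + s - Y) := by rw [hz]
    rcases h.strict with h11 | h11
    · have := mul_lt_mul_of_pos_left h11 hd
      linarith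
    · have := mul_lt_mul_of_pos_left h11 hc
      linarith

/-- At one of the two points few members of both families avoid the point. -/
lemma small_or_small (h : TraceData X Y c d ξ η κ μ p q r s e f δ ε) :
    (q + e ≤ X ∧ s + f ≤ Y) ∨ (p + e ≤ X ∧ r + f ≤ Y) := by
  rcases lt_or_ge (X + c) p with hp | hp
  · exact Or.inl (h.small_of_p_gt hp)
  rcases lt_or_ge (X + c) q with hq | hq
  · exact Or.inr (h.swap.small_of_p_gt hq)
  rcases lt_or_ge (Y + d) r with hr | hr
  · exact Or.inl (h.dual.small_of_p_gt hr).symm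
  rcases lt_or_ge (Y + d) s with hs | hs
  · exact Or.inr (h.dual.swap.small_of_p_gt hs).symm
  exact (h.not_all_le hp hq hr hs).elim

end TraceData

/-! ### Counting the members that avoid one or two points -/

namespace LargePair

variable {n a b l l' : ℕ} {t t' : ℝ} {A B : Finset (Finset ℕ)}

lemma member_card_gt (h : LargePair n a b l l' t t' A B) {v : ℕ}
    (hv : ((A.nonMemberSubfamily v).card : ℝ) < binomPoly t l) :
    (n.choose a : ℝ) - binomPoly t' a < (A.memberSubfamily v).card := by
  have h1 := cast_card_member_add_nonMember v A
  have h2 := h.cardA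
  unfold sizeBound at h2
  linarith

/-- The number of members avoiding a point lies in no intermediate range. -/
lemma nonMember_card_lt (h : LargePair n a b l l' t t' A B) (ha : 2 ≤ a) (hb : 2 ≤ b)
    (htl : (l : ℝ) ≤ t) (htl' : (l' : ℝ) ≤ t') {v : ℕ} (hv : v < n + 1)
    (hA : (A.nonMemberSubfamily v).card ≤ (n - 2).choose l)
    (hB : (B.nonMemberSubfamily v).card ≤ (n - 2).choose l') :
    ((A.nonMemberSubfamily v).card : ℝ) < binomPoly t l := by
  obtain ⟨N, rfl⟩ : ∃ N, n = N + 3 := ⟨n - 3, by have := h.hab; omega⟩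
  have hal := h.hal
  have hbl := h.hbl
  have hl : 1 ≤ l := by have := h.b_le; omega
  have hl' : 1 ≤ l' := by have := h.a_le; omega
  by_contra hlt
  push Not at hlt
  have htN : t ≤ N := by have := h.htn; push_cast at this; linarith
  have htN' : t' ≤ N := by have := h.htn'; push_cast at this; linarith
  have pt : 1 ≤ binomPoly t l := by
    rw [← binomPoly_self l]; exact binomPoly_mono (by linarith) htl
  have pt' : 1 ≤ binomPoly t' l' := by
    rw [← binomPoly_self l']; exact binomPoly_mono (by linarith) htl'
  have hA' : ((A.nonMemberSubfamily v).card : ℝ) ≤ binomPoly ((N + 1 : ℕ) : ℝ) l := by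
    rw [binomPoly_natCast]; exact_mod_cast hA
  have hB' : ((B.nonMemberSubfamily v).card : ℝ) ≤ binomPoly ((N + 1 : ℕ) : ℝ) l' := by
    rw [binomPoly_natCast]; exact_mod_cast hB
  obtain ⟨z, hz, hzA⟩ := exists_binomPoly_eq hl h.ht hlt
  have hzN : z ≤ ((N + 1 : ℕ) : ℝ) := by
    refine le_of_binomPoly_le hl ?_ (by rw [hzA]; exact hA')
    push_cast; linarith
  push_cast at hzN
  have neA : (A.nonMemberSubfamily v).Nonempty := by
    rw [← Finset.card_pos]
    exact_mod_cast (by linarith : (0 : ℝ) < (A.nonMemberSubfamily v).card)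
  have m1 := h.member_card_le hv neA (by linarith [h.ht]) hzA.le
  have c1 := cast_card_member_add_nonMember v A
  have c2 := cast_card_member_add_nonMember v B
  have hcA := h.cardA
  have hcB := h.cardB
  have hst := h.strict
  unfold sizeBound at hcA hcB hst
  have hbm : binomPoly t b ≤ binomPoly z b := by
    refine binomPoly_mono ?_ hz
    have : (b : ℝ) ≤ l := by exact_mod_cast h.b_le
    linarith
  obtain ⟨z', hz', hzB⟩ := exists_binomPoly_eq hl' h.ht'
    (show binomPoly t' l' ≤ (B.nonMemberSubfamily v).card by linarith)
  have hzN' : z' ≤ ((N + 1 : ℕ) : ℝ) := by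
    refine le_of_binomPoly_le hl' ?_ (by rw [hzB]; exact hB')
    push_cast; linarith
  push_cast at hzN'
  have neB : (B.nonMemberSubfamily v).Nonempty := by
    rw [← Finset.card_pos]
    exact_mod_cast (by linarith : (0 : ℝ) < (B.nonMemberSubfamily v).card)
  have m2 := h.symm.member_card_le hv neB (by linarith [h.ht']) hzB.le
  have e1 : N.choose (l - 1) = N.choose (a - 1) := by
    rw [Nat.choose_symm_of_eq_add]; omega
  have e2 : N.choose (l' - 1) = N.choose (b - 1) := by
    rw [Nat.choose_symm_of_eq_add]; omega
  have p1 : (0 : ℝ) < N.choose (a - 1) := by exact_mod_cast Nat.choose_pos (by omega)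
  have p2 : (0 : ℝ) < N.choose (b - 1) := by exact_mod_cast Nat.choose_pos (by omega)
  -- The excess of `A` over C(t, l) forces a proportional excess of `B` over C(t', l'), and
  -- conversely; the factors are reciprocal, so strictness is contradicted.
  have s1 := binomPoly_chord (N := N) h.hb h.b_le h.ht hz htN hzN
  have s2 := binomPoly_chord (N := N) h.ha h.a_le h.ht' hz' htN' hzN'
  rw [e1, hzA] at s1
  rw [e2, hzB] at s2
  have q1 := mul_le_mul_of_nonneg_left (show binomPoly z b - binomPoly t b ≤
    (B.nonMemberSubfamily v).card - binomPoly t' l' by linarith) p1.le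
  have q2 := mul_le_mul_of_nonneg_left (show binomPoly z' a - binomPoly t' a ≤
    (A.nonMemberSubfamily v).card - binomPoly t l by linarith) p2.le
  rcases hst with hst | hst
  · have := mul_lt_mul_of_pos_left (show binomPoly z' a - binomPoly t' a <
      (A.nonMemberSubfamily v).card - binomPoly t l by linarith) p2
    linarith
  · have := mul_lt_mul_of_pos_left (show binomPoly z b - binomPoly t b <
      (B.nonMemberSubfamily v).card - binomPoly t' l' by linarith) p1
    linarith

/-- If few members of `B` avoid `i`, then few members of `A` avoid both `i` and `j`. -/
lemma card_nonMember_nonMember_le (h : LargePair n a b l l' t t' A B) (ha : 2 ≤ a) {i j : ℕ}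
    (hi : i < n + 1) (hj : j < n + 1) (hij : i ≠ j)
    (hB : ((B.nonMemberSubfamily i).card : ℝ) < binomPoly t' l') :
    ((A.nonMemberSubfamily i).nonMemberSubfamily j).card ≤ (n - 3).choose (a - 1) := by
  obtain ⟨N, rfl⟩ : ∃ N, n = N + 3 := ⟨n - 3, by have := h.hab; have := h.hb; omega⟩
  have hal := h.hal
  have hlt := h.add_lt
  have hb := h.hb
  by_contra hc
  push Not at hc
  have e1 : (N + 3 - 3).choose (a - 1) = N.choose (l - 1) := by
    rw [Nat.add_sub_cancel, Nat.choose_symm_of_eq_add]; omega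
  rw [e1] at hc
  have hbl : b ≤ l - 1 := by omega
  have htN : t ≤ N := by have := h.htn; push_cast at this; linarith
  set V := ((range (N + 3 + 1)).erase i).erase j with hV
  have hVc : V.card = N + 2 := by
    rw [hV, Finset.card_erase_of_mem, Finset.card_erase_of_mem, Finset.card_range]
    · rfl
    · simpa using hi
    · simp only [Finset.mem_erase, Finset.mem_range]
      exact ⟨hij.symm, hj⟩
  have hx : ((l - 1 : ℕ) : ℝ) - 1 ≤ N := by
    have : l - 1 ≤ N := by omega
    have : ((l - 1 : ℕ) : ℝ) ≤ N := by exact_mod_cast this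
    linarith
  -- Too many sets of `A` avoiding `i` and `j` exclude C(n-3, b) ≥ C(t, b) sets from those of `B`
  -- that contain `i` but not `j`, leaving the degree of `i` in `B` too small.
  have key := ((h.cross.nonMember_member i).nonMember_nonMember j).card_add_binomPoly_le
    (V := V) (nonMemberSubfamily_subset_powersetCard j (h.sub_nonMember i))
    (nonMemberSubfamily_subset_powersetCard j (h.symm.sub_member i)) hVc (l := l - 1) (by omega)
    hbl (Finset.card_pos.1 (by omega)) (x := N) hx
    (by rw [binomPoly_natCast]; exact_mod_cast hc.le)
  have h1 := h.symm.member_card_gt hB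
  have h2 := cast_card_member_add_nonMember j (B.memberSubfamily i)
  have h3 : (((B.memberSubfamily i).memberSubfamily j).card : ℝ) ≤ ((N + 2).choose (b - 1) : ℝ) := by
    have hsub : B.memberSubfamily i ⊆
        ((range (N + 3 + 1)).erase i).powersetCard (b - 1 + 1) := by
      rw [Nat.sub_add_cancel hb]; exact h.symm.sub_member i
    have := Finset.card_le_card (memberSubfamily_subset_powersetCard j hsub)
    rw [Finset.card_powersetCard, ← hV, hVc] at this
    exact_mod_cast this
  have h4 : binomPoly t b ≤ binomPoly N b := by
    refine binomPoly_mono ?_ htN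
    have : (b : ℝ) ≤ l := by exact_mod_cast h.b_le
    linarith [h.ht]
  have h5 : (N + 3).choose b = (N + 2).choose (b - 1) + (N + 2).choose b := by
    obtain ⟨b, rfl⟩ : ∃ c, b = c + 1 := ⟨b - 1, by omega⟩
    rw [Nat.choose_succ_succ']; rfl
  rw [h5] at h1
  push_cast at h1
  linarith

end LargePair

namespace LargePair

variable {n a b l l' : ℕ} {t t' : ℝ} {A B : Finset (Finset ℕ)}

lemma card_erase_erase {i j : ℕ} (hi : i < n + 1) (hj : j < n + 1) (hij : i ≠ j) :
    (((range (n + 1)).erase i).erase j).card = n - 1 := by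
  rw [Finset.card_erase_of_mem, Finset.card_erase_of_mem, Finset.card_range]
  · rfl
  · simpa using hi
  · simp only [Finset.mem_erase, Finset.mem_range]
    exact ⟨hij.symm, hj⟩

lemma choose_sub_two_l' (h : LargePair n a b l l' t t' A B) :
    (n - 2).choose (b - 1) = (n - 2).choose l' := by
  have := h.hbl; have := h.hb; have := h.hab
  rw [Nat.choose_symm_of_eq_add]; omega

lemma choose_sub_three (h : LargePair n a b l l' t t' A B) (ha : 2 ≤ a) (hb : 2 ≤ b) :
    ((n - 2).choose l : ℝ) = (n - 3).choose l + (n - 3).choose (a - 1) := by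
  have := h.hal; have := h.hab
  obtain ⟨N, rfl⟩ : ∃ N, n = N + 3 := ⟨n - 3, by omega⟩
  obtain ⟨l, rfl⟩ : ∃ c, l = c + 1 := ⟨l - 1, by have := h.b_le; omega⟩
  have e1 : N.choose (a - 1) = N.choose l := by
    rw [Nat.choose_symm_of_eq_add]; omega
  have e2 : N + 3 - 2 = N + 1 := rfl
  rw [e2, Nat.add_sub_cancel, Nat.choose_succ_succ', e1]
  push_cast; ring

lemma lovaszBound_sub (h : LargePair n a b l l' t t' A B) (ha : 2 ≤ a) (hb : 2 ≤ b) :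
    lovaszBound l b ((n - 2).choose l : ℝ) - lovaszBound l b ((n - 3).choose l : ℝ) =
      (n - 3).choose (b - 1) := by
  have := h.hal; have := h.hab; have := h.b_le
  rw [lovaszBound_choose (by omega) _ _ (by omega), lovaszBound_choose (by omega) _ _ (by omega)]
  obtain ⟨N, rfl⟩ : ∃ N, n = N + 3 := ⟨n - 3, by omega⟩
  obtain ⟨b, rfl⟩ : ∃ c, b = c + 1 := ⟨b - 1, by omega⟩
  have e2 : N + 3 - 2 = N + 1 := rfl
  rw [e2, Nat.add_sub_cancel, Nat.choose_succ_succ']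
  push_cast; simp

lemma choose_sub_one (h : LargePair n a b l l' t t' A B) (ha : 2 ≤ a) (hb : 2 ≤ b) :
    ((n - 1).choose b : ℝ) = (n - 2).choose l' + lovaszBound l b ((n - 2).choose l : ℝ) := by
  have := h.hal; have := h.hab; have := h.b_le
  rw [lovaszBound_choose (by omega) _ _ (by omega), ← h.choose_sub_two_l']
  obtain ⟨N, rfl⟩ : ∃ N, n = N + 2 := ⟨n - 2, by omega⟩
  obtain ⟨b, rfl⟩ : ∃ c, b = c + 1 := ⟨b - 1, by omega⟩
  have e2 : N + 2 - 1 = N + 1 := rfl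
  rw [e2, Nat.add_sub_cancel, Nat.choose_succ_succ']
  push_cast; simp

lemma trace_le (h : LargePair n a b l l' t t' A B) (ha : 2 ≤ a) (hb : 2 ≤ b) {i j : ℕ}
    (hi : i < n + 1) (hj : j < n + 1) (hij : i ≠ j)
    (h0 : (0 : ℝ) < ((A.nonMemberSubfamily i).memberSubfamily j).card) :
    (((B.memberSubfamily i).nonMemberSubfamily j).card : ℝ) ≤
      (n - 2).choose l' + lovaszBound l b ((n - 2).choose l : ℝ) -
        lovaszBound l b ((A.nonMemberSubfamily i).memberSubfamily j).card := by
  have := h.hal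
  have key := ((h.cross.nonMember_member i).member_nonMember j).card_add_lovaszBound_le
    (memberSubfamily_subset_powersetCard j (h.sub_nonMember i))
    (nonMemberSubfamily_subset_powersetCard j (h.symm.sub_member i)) (card_erase_erase hi hj hij)
    (l := l) (by omega) (by have := h.b_le; omega) h.b_le
    (Finset.card_pos.1 (by exact_mod_cast h0))
  rw [h.choose_sub_one ha hb] at key
  linarith

lemma trace_le' (h : LargePair n a b l l' t t' A B) (ha : 2 ≤ a) (hb : 2 ≤ b) {i j : ℕ}
    (hi : i < n + 1) (hj : j < n + 1) (hij : i ≠ j)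
    (h0 : (0 : ℝ) < ((A.memberSubfamily i).nonMemberSubfamily j).card) :
    (((B.nonMemberSubfamily i).memberSubfamily j).card : ℝ) ≤
      (n - 2).choose l' + lovaszBound l b ((n - 2).choose l : ℝ) -
        lovaszBound l b ((A.memberSubfamily i).nonMemberSubfamily j).card := by
  rw [member_nonMember_comm A hij] at h0 ⊢
  rw [← member_nonMember_comm B hij.symm]
  exact h.trace_le ha hb hj hi hij.symm h0

/-- A concave function that is nonnegative at 0 lies above the line from the origin to its value at
C(n-3, a-1). -/
lemma missing_le (h : LargePair n a b l l' t t' A B) (ha : 2 ≤ a) (hb : 2 ≤ b) {i j : ℕ}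
    (hi : i < n + 1) (hj : j < n + 1) (hij : i ≠ j)
    (he : ((A.nonMemberSubfamily i).nonMemberSubfamily j).card ≤ (n - 3).choose (a - 1)) :
    ((n - 3).choose (b - 1) : ℝ) * ((A.nonMemberSubfamily i).nonMemberSubfamily j).card ≤
      (n - 3).choose (a - 1) *
        ((n - 1).choose (b - 1) - ((B.memberSubfamily i).memberSubfamily j).card) := by
  have hal := h.hal
  have hlt := h.add_lt
  have hsub : B.memberSubfamily i ⊆ ((range (n + 1)).erase i).powersetCard (b - 1 + 1) := by
    rw [Nat.sub_add_cancel h.hb]; exact h.symm.sub_member i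
  have hsub' := memberSubfamily_subset_powersetCard j hsub
  rcases ((A.nonMemberSubfamily i).nonMemberSubfamily j).eq_empty_or_nonempty with h0 | hne
  · rw [h0, Finset.card_empty, Nat.cast_zero, mul_zero]
    apply mul_nonneg (by positivity)
    have := Finset.card_le_card hsub'
    rw [Finset.card_powersetCard, card_erase_erase hi hj hij] at this
    rw [sub_nonneg]
    exact_mod_cast this
  · have hl1 : 1 ≤ l - 1 := by omega
    have hbl : b - 1 ≤ l - 1 := by have := h.b_le; omega
    have key := ((h.cross.nonMember_member i).nonMember_member j).card_add_lovaszBound_le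
      (nonMemberSubfamily_subset_powersetCard j (h.sub_nonMember i)) hsub'
      (card_erase_erase hi hj hij) (l := l - 1) (by omega) hl1 hbl hne
    have e1 : (n - 3).choose (a - 1) = (n - 3).choose (l - 1) := by
      rw [Nat.choose_symm_of_eq_add]; omega
    have c1 : 0 < (n - 3).choose (a - 1) := Nat.choose_pos (by omega)
    have hc := (concaveOn_lovaszBound hl1 hbl).chord_le (w := 0)
      (x := ((A.nonMemberSubfamily i).nonMemberSubfamily j).card) (y := 0)
      (z := (n - 3).choose (a - 1)) le_rfl (by positivity) le_rfl (by exact_mod_cast he)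
      (by exact_mod_cast c1)
    have h2 := lovaszBound_choose hl1 (b - 1) (n - 3) (by omega)
    rw [← e1] at h2
    rw [h2, sub_zero, sub_zero] at hc
    have h3 := lovaszBound_nonneg hl1 hbl le_rfl
    have h4 : (((A.nonMemberSubfamily i).nonMemberSubfamily j).card : ℝ) ≤
        (n - 3).choose (a - 1) := by exact_mod_cast he
    have h5 := mul_le_mul_of_nonneg_left h4 h3
    have h6 := mul_le_mul_of_nonneg_left
      (show lovaszBound (l - 1) (b - 1) ((A.nonMemberSubfamily i).nonMemberSubfamily j).card ≤
        (n - 1).choose (b - 1) - ((B.memberSubfamily i).memberSubfamily j).card by linarith)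
      (show (0 : ℝ) ≤ (n - 3).choose (a - 1) by positivity)
    linarith

lemma trace_sizeBound (h : LargePair n a b l l' t t' A B) (ha : 2 ≤ a) (hb : 2 ≤ b) {i j : ℕ} :
    (sizeBound n a l t t' ≤ A.card ↔ (n - 2).choose l + lovaszBound l' a ((n - 2).choose l' : ℝ) -
      lovaszBound l' a (binomPoly t' l') + binomPoly t l ≤
        ((A.memberSubfamily i).nonMemberSubfamily j).card +
        ((A.nonMemberSubfamily i).memberSubfamily j).card +
        ((A.nonMemberSubfamily i).nonMemberSubfamily j).card -
        ((n - 1).choose (a - 1) - ((A.memberSubfamily i).memberSubfamily j).card)) ∧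
    (sizeBound n a l t t' < A.card ↔ (n - 2).choose l + lovaszBound l' a ((n - 2).choose l' : ℝ) -
      lovaszBound l' a (binomPoly t' l') + binomPoly t l <
        ((A.memberSubfamily i).nonMemberSubfamily j).card +
        ((A.nonMemberSubfamily i).memberSubfamily j).card +
        ((A.nonMemberSubfamily i).nonMemberSubfamily j).card -
        ((n - 1).choose (a - 1) - ((A.memberSubfamily i).memberSubfamily j).card)) := by
  have h1 := cast_card_member_add_nonMember i A
  have h2 := cast_card_member_add_nonMember j (A.memberSubfamily i)
  have h3 := cast_card_member_add_nonMember j (A.nonMemberSubfamily i)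
  have h4 := h.symm.choose_sub_one hb ha
  have h5 := lovaszBound_binomPoly (l := l') (by have := h.a_le; omega) a h.ht'
  have h6 : (n.choose a : ℝ) = (n - 1).choose (a - 1) + (n - 1).choose a := by
    obtain ⟨N, rfl⟩ : ∃ N, n = N + 1 := ⟨n - 1, by have := h.hab; omega⟩
    obtain ⟨a, rfl⟩ : ∃ c, a = c + 1 := ⟨a - 1, by omega⟩
    rw [Nat.choose_succ_succ']; push_cast; simp
  unfold sizeBound
  rw [h5, h6]
  constructor <;> constructor <;> intro h7 <;> linarith

/-- If few members avoid both `i` and `j`, then few members avoid `i` or few members avoid `j`. -/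
lemma nonMember_small_or_small (h : LargePair n a b l l' t t' A B) (ha : 2 ≤ a) (hb : 2 ≤ b)
    (htl : (l : ℝ) ≤ t) (htl' : (l' : ℝ) ≤ t') {i j : ℕ}
    (hi : i < n + 1) (hj : j < n + 1) (hij : i ≠ j)
    (he : ((A.nonMemberSubfamily i).nonMemberSubfamily j).card ≤ (n - 3).choose (a - 1))
    (hf : ((B.nonMemberSubfamily i).nonMemberSubfamily j).card ≤ (n - 3).choose (b - 1)) :
    ((A.nonMemberSubfamily i).card ≤ (n - 2).choose l ∧
      (B.nonMemberSubfamily i).card ≤ (n - 2).choose l') ∨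
    ((A.nonMemberSubfamily j).card ≤ (n - 2).choose l ∧
      (B.nonMemberSubfamily j).card ≤ (n - 2).choose l') := by
  have hab := h.hab
  have hal := h.hal
  have hbl := h.hbl
  have hle := h.a_le
  have hle' := h.b_le
  have n3 : ((n - 3 : ℕ) : ℝ) = n - 3 := by rw [Nat.cast_sub (by omega)]; simp
  -- `X` and `Y` correspond to the parameter n - 2, while X - c and Y - d correspond to n - 3, so ξ
  -- ≤ X - c and η ≤ Y - d express t, t' ≤ n - 3.
  have key : TraceData ((n - 2).choose l) ((n - 2).choose l') ((n - 3).choose (a - 1))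
      ((n - 3).choose (b - 1)) (binomPoly t l) (binomPoly t' l') (lovaszBound l b)
      (lovaszBound l' a) ((A.memberSubfamily i).nonMemberSubfamily j).card
      ((A.nonMemberSubfamily i).memberSubfamily j).card
      ((B.memberSubfamily i).nonMemberSubfamily j).card
      ((B.nonMemberSubfamily i).memberSubfamily j).card
      ((A.nonMemberSubfamily i).nonMemberSubfamily j).card
      ((B.nonMemberSubfamily i).nonMemberSubfamily j).card
      ((n - 1).choose (a - 1) - ((A.memberSubfamily i).memberSubfamily j).card)
      ((n - 1).choose (b - 1) - ((B.memberSubfamily i).memberSubfamily j).card) :=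
    { hκ := concaveOn_lovaszBound (by omega) hle'
      hμ := concaveOn_lovaszBound (by omega) hle
      mκ := lovaszBound_monotoneOn (by omega) hle'
      mμ := lovaszBound_monotoneOn (by omega) hle
      hc := by exact_mod_cast Nat.choose_pos (by omega)
      hd := by exact_mod_cast Nat.choose_pos (by omega)
      κX := by
        rw [h.choose_sub_three ha hb, add_sub_cancel_right, ← h.choose_sub_three ha hb]
        exact h.lovaszBound_sub ha hb
      μY := by
        rw [h.symm.choose_sub_three hb ha, add_sub_cancel_right, ← h.symm.choose_sub_three hb ha]
        exact h.symm.lovaszBound_sub hb ha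
      hξ := binomPoly_pos (by linarith)
      hη := binomPoly_pos (by linarith)
      hξX := by
        rw [h.choose_sub_three ha hb, add_sub_cancel_right, ← binomPoly_natCast]
        exact binomPoly_mono h.ht (by rw [n3]; exact h.htn)
      hηY := by
        rw [h.symm.choose_sub_three hb ha, add_sub_cancel_right, ← binomPoly_natCast]
        exact binomPoly_mono h.ht' (by rw [n3]; exact h.htn')
      ps := h.symm.trace_le hb ha hi hj hij
      sp := h.trace_le' ha hb hi hj hij
      qr := h.symm.trace_le' hb ha hi hj hij
      rq := h.trace_le ha hb hi hj hij
      he0 := by positivity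
      hf0 := by positivity
      he := by exact_mod_cast he
      hf := by exact_mod_cast hf
      hδ := h.symm.missing_le hb ha hi hj hij hf
      hε := h.missing_le ha hb hi hj hij he
      hA := (h.trace_sizeBound ha hb).1.1 h.cardA
      hB := (h.symm.trace_sizeBound hb ha).1.1 h.cardB
      strict := h.strict.imp (h.trace_sizeBound ha hb).2.1 (h.symm.trace_sizeBound hb ha).2.1 }
  have c1 := fun E : Finset (Finset ℕ) => cast_card_member_add_nonMember j (E.nonMemberSubfamily i)
  have c2 := fun E : Finset (Finset ℕ) => cast_card_member_add_nonMember i (E.nonMemberSubfamily j)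
  have c3 : ∀ E : Finset (Finset ℕ), ((E.nonMemberSubfamily j).card : ℝ) =
      ((E.memberSubfamily i).nonMemberSubfamily j).card +
        ((E.nonMemberSubfamily i).nonMemberSubfamily j).card := by
    intro E
    rw [← c2 E, member_nonMember_comm E hij, nonMemberSubfamily_comm E j i]
  refine key.small_or_small.imp (fun hs => ?_) (fun hs => ?_)
  · rw [c1, c1] at hs
    exact_mod_cast hs
  · rw [← c3, ← c3] at hs
    exact_mod_cast hs

end LargePair

/-! ### The shifting operation -/

/-- The set obtained from the member `X` of `A` by the shift replacing `j` by `i`. -/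
def shiftSet (i j : ℕ) (A : Finset (Finset ℕ)) (X : Finset ℕ) : Finset ℕ :=
  if j ∈ X ∧ i ∉ X ∧ insert i (X.erase j) ∉ A then insert i (X.erase j) else X

/-- The shift of the family `A` replacing `j` by `i`. -/
def shiftFamily (i j : ℕ) (A : Finset (Finset ℕ)) : Finset (Finset ℕ) := A.image (shiftSet i j A)

section Shift
variable {i j : ℕ} {A B : Finset (Finset ℕ)}

lemma shiftSet_injOn (i j : ℕ) (A : Finset (Finset ℕ)) : Set.InjOn (shiftSet i j A) A := by
  intro X hX Y hY hXY
  rw [Finset.mem_coe] at hX hY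
  unfold shiftSet at hXY
  split_ifs at hXY with h1 h2 h2
  · have e : ∀ Z : Finset ℕ, j ∈ Z → i ∉ Z → insert j ((insert i (Z.erase j)).erase i) = Z := by
      intro Z hj hi
      rw [Finset.erase_insert (fun h => hi (Finset.mem_of_mem_erase h)), Finset.insert_erase hj]
    rw [← e X h1.1 h1.2.1, hXY, e Y h2.1 h2.2.1]
  · rw [hXY] at h1
    exact absurd hY h1.2.2
  · rw [← hXY] at h2
    exact absurd hX h2.2.2
  · exact hXY

lemma card_shiftFamily (i j : ℕ) (A : Finset (Finset ℕ)) : (shiftFamily i j A).card = A.card :=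
  Finset.card_image_of_injOn (shiftSet_injOn i j A)

lemma shiftFamily_subset_powersetCard {V : Finset ℕ} {a : ℕ} (hi : i ∈ V)
    (hA : A ⊆ V.powersetCard a) : shiftFamily i j A ⊆ V.powersetCard a := by
  intro Z hZ
  obtain ⟨X, hX, rfl⟩ := Finset.mem_image.1 hZ
  have hX' := Finset.mem_powersetCard.1 (hA hX)
  unfold shiftSet
  split_ifs with h
  · rw [Finset.mem_powersetCard, Finset.card_insert_of_notMem
      (fun h' => h.2.1 (Finset.mem_of_mem_erase h')), Finset.card_erase_add_one h.1]
    exact ⟨Finset.insert_subset hi ((Finset.erase_subset _ _).trans hX'.1), hX'.2⟩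
  · exact hA hX

/-- Disjointness would force j ∈ Y and i ∉ Y; as `Y` stays put, its shifted copy is already in `B`,
and that copy would miss `X`. -/
lemma not_disjoint_shiftSet (h : CrossMeet A B) {X Y : Finset ℕ} (hX : X ∈ A) (hY : Y ∈ B)
    (h1 : j ∈ X ∧ i ∉ X ∧ insert i (X.erase j) ∉ A)
    (h2 : ¬ (j ∈ Y ∧ i ∉ Y ∧ insert i (Y.erase j) ∉ B)) :
    ¬ Disjoint (insert i (X.erase j)) Y := by
  intro hd
  rw [Finset.disjoint_insert_left] at hd
  have hjY : j ∈ Y := by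
    by_contra hj
    apply h X hX Y hY
    rw [Finset.disjoint_left]
    intro x hx hxY
    exact Finset.disjoint_left.1 hd.2 (Finset.mem_erase.2 ⟨fun e => hj (e ▸ hxY), hx⟩) hxY
  have hY' : insert i (Y.erase j) ∈ B := by
    by_contra hn
    exact h2 ⟨hjY, hd.1, hn⟩
  apply h X hX _ hY'
  rw [Finset.disjoint_insert_right]
  refine ⟨h1.2.1, ?_⟩
  rw [Finset.disjoint_left]
  intro x hx hxY
  rw [Finset.mem_erase] at hxY
  exact Finset.disjoint_left.1 hd.2 (Finset.mem_erase.2 ⟨hxY.1, hx⟩) hxY.2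

lemma CrossMeet.shiftFamily (h : CrossMeet A B) (i j : ℕ) :
    CrossMeet (shiftFamily i j A) (shiftFamily i j B) := by
  intro X' hX' Y' hY'
  obtain ⟨X, hX, rfl⟩ := Finset.mem_image.1 hX'
  obtain ⟨Y, hY, rfl⟩ := Finset.mem_image.1 hY'
  unfold shiftSet
  split_ifs with h1 h2 h2
  · intro hd
    exact Finset.disjoint_left.1 hd (Finset.mem_insert_self _ _) (Finset.mem_insert_self _ _)
  · exact not_disjoint_shiftSet h hX hY h1 h2
  · exact fun hd => not_disjoint_shiftSet h.symm hY hX h2 h1 hd.symm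
  · exact h X hX Y hY

/-- Hence a center of the shifted pair other than `i` was already a center. -/
lemma card_nonMemberSubfamily_le_shiftFamily {k : ℕ} (hk : k ≠ i) :
    (A.nonMemberSubfamily k).card ≤ ((shiftFamily i j A).nonMemberSubfamily k).card := by
  refine Finset.card_le_card_of_injOn (shiftSet i j A) ?_
    ((shiftSet_injOn i j A).mono (by exact_mod_cast Finset.filter_subset _ _))
  intro X hX
  rw [Finset.mem_coe, Finset.mem_nonMemberSubfamily] at hX ⊢
  refine ⟨Finset.mem_image_of_mem _ hX.1, ?_⟩
  unfold shiftSet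
  split_ifs
  · rw [Finset.mem_insert, not_or]
    exact ⟨hk, fun h => hX.2 (Finset.mem_of_mem_erase h)⟩
  · exact hX.2

lemma nonMember_nonMember_subset_shiftFamily :
    (A.nonMemberSubfamily i).nonMemberSubfamily j ⊆
      ((shiftFamily i j A).nonMemberSubfamily i).nonMemberSubfamily j := by
  intro X hX
  simp only [Finset.mem_nonMemberSubfamily] at hX ⊢
  refine ⟨⟨Finset.mem_image.2 ⟨X, hX.1.1, ?_⟩, hX.1.2⟩, hX.2⟩
  unfold shiftSet
  rw [if_neg fun h => hX.2 h.1]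

lemma sum_shiftSet_le (hij : i < j) (X : Finset ℕ) : ∑ x ∈ shiftSet i j A X, x ≤ ∑ x ∈ X, x := by
  unfold shiftSet
  split_ifs with h
  · rw [Finset.sum_insert (fun h' => h.2.1 (Finset.mem_of_mem_erase h')),
      ← Finset.add_sum_erase X _ h.1]
    omega
  · rfl

/-- The sum of the elements of all members. -/
def familyWeight (A : Finset (Finset ℕ)) : ℕ := ∑ X ∈ A, ∑ x ∈ X, x

lemma familyWeight_shiftFamily (i j : ℕ) (A : Finset (Finset ℕ)) :
    familyWeight (shiftFamily i j A) = ∑ X ∈ A, ∑ x ∈ shiftSet i j A X, x :=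
  Finset.sum_image (shiftSet_injOn i j A)

lemma familyWeight_shiftFamily_le (hij : i < j) :
    familyWeight (shiftFamily i j A) ≤ familyWeight A := by
  rw [familyWeight_shiftFamily]
  exact Finset.sum_le_sum fun X _ => sum_shiftSet_le hij X

lemma familyWeight_shiftFamily_lt (hij : i < j) {X : Finset ℕ} (hX : X ∈ A)
    (h : j ∈ X ∧ i ∉ X ∧ insert i (X.erase j) ∉ A) :
    familyWeight (shiftFamily i j A) < familyWeight A := by
  rw [familyWeight_shiftFamily]
  refine Finset.sum_lt_sum (fun X _ => sum_shiftSet_le hij X) ⟨X, hX, ?_⟩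
  unfold shiftSet
  rw [if_pos h, Finset.sum_insert (fun h' => h.2.1 (Finset.mem_of_mem_erase h')),
    ← Finset.add_sum_erase X _ h.1]
  omega

lemma exists_of_not_shifted (h : ¬ Shifted A) :
    ∃ X ∈ A, ∃ i j, i < j ∧ j ∈ X ∧ i ∉ X ∧ insert i (X.erase j) ∉ A := by
  unfold Shifted at h
  push Not at h
  exact h

end Shift

/-! ### Undoing the shifts, and degrees -/

namespace LargePair

variable {n a b l l' : ℕ} {t t' : ℝ} {A B : Finset (Finset ℕ)}

lemma shiftFamily (h : LargePair n a b l l' t t' A B) {i : ℕ} (hi : i < n + 1) (j : ℕ) :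
    LargePair n a b l l' t t' (shiftFamily i j A) (shiftFamily i j B) :=
  { h with
    subA := shiftFamily_subset_powersetCard (Finset.mem_range.2 hi) h.subA
    subB := shiftFamily_subset_powersetCard (Finset.mem_range.2 hi) h.subB
    cross := h.cross.shiftFamily i j
    cardA := by rw [card_shiftFamily]; exact h.cardA
    cardB := by rw [card_shiftFamily]; exact h.cardB
    strict := by rw [card_shiftFamily, card_shiftFamily]; exact h.strict
    strictA := by rw [card_shiftFamily]; exact h.strictA
    strictB := by rw [card_shiftFamily]; exact h.strictB }

lemma nonMember_card_lt_of_member_card_gt (h : LargePair n a b l l' t t' A B)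
    (htl : (l : ℝ) ≤ t) {v : ℕ} (hv : v < n + 1)
    (hB : (n.choose b : ℝ) - binomPoly t b < (B.memberSubfamily v).card) :
    ((A.nonMemberSubfamily v).card : ℝ) < binomPoly t l := by
  by_contra hc
  push Not at hc
  have h0 : 0 < binomPoly t l := binomPoly_pos (by linarith)
  have hne : (A.nonMemberSubfamily v).Nonempty :=
    Finset.card_pos.1 (by exact_mod_cast lt_of_lt_of_le h0 hc)
  have := h.member_card_le hv hne h.ht hc
  linarith

/-- Few members of both families avoid the point `v`. -/
def IsCenter (t t' : ℝ) (l l' : ℕ) (A B : Finset (Finset ℕ)) (v : ℕ) : Prop :=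
  ((A.nonMemberSubfamily v).card : ℝ) < binomPoly t l ∧
  ((B.nonMemberSubfamily v).card : ℝ) < binomPoly t' l'

/-- When the center is `i`, few shifted sets avoid both `i` and `j`, and shifting does not move sets
avoiding both. The trace inequalities then make `i` or `j` a center of the original pair. -/
lemma isCenter_of_shiftFamily (h : LargePair n a b l l' t t' A B) (ha : 2 ≤ a) (hb : 2 ≤ b)
    (htl : (l : ℝ) ≤ t) (htl' : (l' : ℝ) ≤ t') {i j : ℕ} (hi : i < n + 1) (hj : j < n + 1)
    (hij : i ≠ j)
    (hc : ∃ v < n + 1, IsCenter t t' l l' (_root_.shiftFamily i j A) (_root_.shiftFamily i j B) v) :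
    ∃ v < n + 1, IsCenter t t' l l' A B v := by
  obtain ⟨v, hv, h1, h2⟩ := hc
  by_cases hvi : v = i
  · subst hvi
    have h' := h.shiftFamily hi j
    have he := h'.card_nonMember_nonMember_le ha hi hj hij h2
    have hf := h'.symm.card_nonMember_nonMember_le hb hi hj hij h1
    rcases h.nonMember_small_or_small ha hb htl htl' hi hj hij
      ((Finset.card_le_card nonMember_nonMember_subset_shiftFamily).trans he)
      ((Finset.card_le_card nonMember_nonMember_subset_shiftFamily).trans hf) with hs | hs
    · exact ⟨v, hi, h.nonMember_card_lt ha hb htl htl' hi hs.1 hs.2,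
        h.symm.nonMember_card_lt hb ha htl' htl hi hs.2 hs.1⟩
    · exact ⟨j, hj, h.nonMember_card_lt ha hb htl htl' hj hs.1 hs.2,
        h.symm.nonMember_card_lt hb ha htl' htl hj hs.2 hs.1⟩
  · refine ⟨v, hv, lt_of_le_of_lt ?_ h1, lt_of_le_of_lt ?_ h2⟩
    · exact_mod_cast card_nonMemberSubfamily_le_shiftFamily hvi
    · exact_mod_cast card_nonMemberSubfamily_le_shiftFamily hvi

/-- A nontrivial shift lowers the total weight; a pair admitting none is shifted and has center 0.
-/
theorem exists_isCenter (ha : 2 ≤ a) (hb : 2 ≤ b) (htl : (l : ℝ) ≤ t) (htl' : (l' : ℝ) ≤ t') :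
    ∀ (m : ℕ) (A B : Finset (Finset ℕ)), familyWeight A + familyWeight B = m →
      LargePair n a b l l' t t' A B → ∃ v < n + 1, IsCenter t t' l l' A B v := by
  intro m
  induction m using Nat.strong_induction_on with
  | _ m ih =>
  intro A B hm h
  by_cases hA : Shifted A
  · by_cases hB : Shifted B
    · obtain ⟨h1, h2⟩ := shifted_bounds _ _ _ _ _ _ _ _ _ h hA hB
      exact ⟨0, Nat.succ_pos n, h.nonMember_card_lt_of_member_card_gt htl (Nat.succ_pos n) h2,
        h.symm.nonMember_card_lt_of_member_card_gt htl' (Nat.succ_pos n) h1⟩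
    · obtain ⟨X, hX, i, j, hij, hX'⟩ := exists_of_not_shifted hB
      have hj : j < n + 1 :=
        Finset.mem_range.1 ((Finset.mem_powersetCard.1 (h.subB hX)).1 hX'.1)
      have w1 := familyWeight_shiftFamily_lt hij hX hX'
      have w2 := familyWeight_shiftFamily_le (A := A) hij
      exact h.isCenter_of_shiftFamily ha hb htl htl' (by omega) hj hij.ne
        (ih _ (by omega) _ _ rfl (h.shiftFamily (by omega) j))
  · obtain ⟨X, hX, i, j, hij, hX'⟩ := exists_of_not_shifted hA
    have hj : j < n + 1 :=
      Finset.mem_range.1 ((Finset.mem_powersetCard.1 (h.subA hX)).1 hX'.1)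
    have w1 := familyWeight_shiftFamily_lt hij hX hX'
    have w2 := familyWeight_shiftFamily_le (A := B) hij
    exact h.isCenter_of_shiftFamily ha hb htl htl' (by omega) hj hij.ne
      (ih _ (by omega) _ _ rfl (h.shiftFamily (by omega) j))

end LargePair

namespace LargePair

variable {n a b l l' : ℕ} {t t' : ℝ} {A B : Finset (Finset ℕ)}

/-- An element avoided by few members has larger degree than every other element. -/
lemma member_card_lt_of_nonMember_lt (h : LargePair n a b l l' t t' A B) (ha : 2 ≤ a)
    {i j : ℕ} (hi : i < n + 1) (hj : j < n + 1) (hij : i ≠ j)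
    (hA : ((A.nonMemberSubfamily i).card : ℝ) < binomPoly t l) :
    (A.memberSubfamily j).card < (A.memberSubfamily i).card := by
  have hal := h.hal
  have hbl := h.b_le
  have hb := h.hb
  have h1 := h.member_card_gt hA
  obtain ⟨N, rfl⟩ : ∃ N, n = N + 3 := ⟨n - 3, by omega⟩
  obtain ⟨a, rfl⟩ : ∃ c, a = c + 2 := ⟨a - 2, by omega⟩
  have htn := h.htn
  have htn' := h.htn'
  push_cast at htn htn'
  have h2 : binomPoly t' (a + 2) ≤ (N.choose (a + 2) : ℝ) := by
    rw [← binomPoly_natCast]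
    refine binomPoly_mono ?_ (by linarith)
    have : ((a + 2 : ℕ) : ℝ) ≤ l' := by exact_mod_cast h.a_le
    linarith [h.ht']
  have h3 : binomPoly t l ≤ (N.choose l : ℝ) := by
    rw [← binomPoly_natCast]
    exact binomPoly_mono h.ht (by linarith)
  have h4 := cast_card_member_add_nonMember j (A.memberSubfamily i)
  have h5 := cast_card_member_add_nonMember i (A.memberSubfamily j)
  have h6 := cast_card_member_add_nonMember j (A.nonMemberSubfamily i)
  rw [memberSubfamily_comm A hij.symm, member_nonMember_comm A hij.symm] at h5
  have h7 : ((((A.memberSubfamily i).memberSubfamily j).card : ℕ) : ℝ) ≤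
      ((N + 2).choose (a + 1) : ℕ) := by
    have := Finset.card_le_card (memberSubfamily_subset_powersetCard j (h.sub_member i))
    rw [Finset.card_powersetCard, card_erase_erase hi hj hij] at this
    exact_mod_cast this
  have h8 : (N.choose l : ℝ) ≤ ((N + 1).choose (a + 1) : ℕ) := by
    rw [show (N + 1).choose (a + 1) = (N + 1).choose l from
      Nat.choose_symm_of_eq_add (by omega)]
    exact_mod_cast Nat.choose_le_choose l (Nat.le_succ N)
  -- At most C(N+2, a+1) members contain both points, so more than C(N+1, a+1) contain `i` alone;
  -- fewer than C(N, l) ≤ C(N+1, a+1) contain `j` alone.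
  have h9 : (((N + 3).choose (a + 2) : ℕ) : ℝ) = (N + 2).choose (a + 1) +
      ((N + 1).choose (a + 1) + (N.choose (a + 1) + N.choose (a + 2))) := by
    exact_mod_cast (by simp only [Nat.choose_succ_succ'] : (N + 3).choose (a + 2) =
      (N + 2).choose (a + 1) + ((N + 1).choose (a + 1) + (N.choose (a + 1) + N.choose (a + 2))))
  have h10 : (0 : ℝ) ≤ N.choose (a + 1) := by positivity
  have h11 : (0 : ℝ) ≤ ((A.nonMemberSubfamily i).nonMemberSubfamily j).card := by positivity
  have : ((A.memberSubfamily j).card : ℝ) < (A.memberSubfamily i).card := by linarith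
  exact_mod_cast this

end LargePair

/-! ### Transfer to families on `Fin n` -/

section Transfer
variable {n : ℕ}

/-- A family of subsets of `Fin n` as a family of sets of natural numbers. -/
def valFamily (A : Finset (Finset (Fin n))) : Finset (Finset ℕ) :=
  A.map (Finset.mapEmbedding Fin.valEmbedding).toEmbedding

lemma mem_valFamily {A : Finset (Finset (Fin n))} {X : Finset ℕ} :
    X ∈ valFamily A ↔ ∃ F ∈ A, F.map Fin.valEmbedding = X := by
  simp [valFamily]

lemma card_valFamily (A : Finset (Finset (Fin n))) : (valFamily A).card = A.card :=
  Finset.card_map _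

lemma valFamily_subset {A : Finset (Finset (Fin n))} {a : ℕ} (hA : ∀ F ∈ A, F.card = a) :
    valFamily A ⊆ (range n).powersetCard a := by
  intro X hX
  obtain ⟨F, hF, rfl⟩ := mem_valFamily.1 hX
  rw [Finset.mem_powersetCard, Finset.card_map]
  refine ⟨fun x hx => ?_, hA F hF⟩
  obtain ⟨y, -, rfl⟩ := Finset.mem_map.1 hx
  exact Finset.mem_range.2 y.2

lemma CrossIntersecting.crossMeet {A B : Finset (Finset (Fin n))} (h : CrossIntersecting A B) :
    CrossMeet (valFamily A) (valFamily B) := by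
  intro X hX Y hY
  obtain ⟨F, hF, rfl⟩ := mem_valFamily.1 hX
  obtain ⟨G, hG, rfl⟩ := mem_valFamily.1 hY
  rw [Finset.disjoint_map, Finset.disjoint_iff_inter_eq_empty]
  exact (h F hF G hG).ne_empty

lemma valFamily_filter (A : Finset (Finset (Fin n))) (i : Fin n) :
    (valFamily A).nonMemberSubfamily (i : ℕ) = valFamily (A.filter fun F => i ∉ F) := by
  ext X
  simp only [Finset.mem_nonMemberSubfamily, mem_valFamily, Finset.mem_filter]
  constructor
  · rintro ⟨⟨F, hF, rfl⟩, hi⟩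
    exact ⟨F, ⟨hF, fun h => hi (Finset.mem_map_of_mem Fin.valEmbedding h)⟩, rfl⟩
  · rintro ⟨F, ⟨hF, hi⟩, rfl⟩
    exact ⟨⟨F, hF, rfl⟩, fun h => hi ((Finset.mem_map' Fin.valEmbedding).1 h)⟩

lemma card_nonMember_valFamily (A : Finset (Finset (Fin n))) (i : Fin n) :
    ((valFamily A).nonMemberSubfamily (i : ℕ)).card = (A.filter fun F => i ∉ F).card := by
  rw [valFamily_filter, card_valFamily]

lemma card_member_valFamily (A : Finset (Finset (Fin n))) (i : Fin n) :
    ((valFamily A).memberSubfamily (i : ℕ)).card = familyDegree A i := by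
  have h1 := Finset.card_memberSubfamily_add_card_nonMemberSubfamily (i : ℕ) (valFamily A)
  have h2 := Finset.card_filter_add_card_filter_not (s := A) (fun F => i ∈ F)
  rw [card_nonMember_valFamily, card_valFamily] at h1
  unfold familyDegree
  omega

lemma diversity_le (A : Finset (Finset (Fin n))) (i : Fin n) :
    diversity A ≤ ((valFamily A).nonMemberSubfamily (i : ℕ)).card := by
  rw [card_nonMember_valFamily]
  exact ciInf_le (OrderBot.bddBelow _) i

lemma realChoose_of_le {x : ℝ} {k : ℕ} (h : (k : ℝ) ≤ x) : realChoose x k = binomPoly x k :=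
  if_pos h

end Transfer

theorem mainTheorem1 (n a b : ℕ) (ha : 0 < a) (hb : 0 < b) (hn : a + b ≤ n)
    (A B : Finset (Finset (Fin n)))
    (hA : ∀ F ∈ A, F.card = a) (hB : ∀ G ∈ B, G.card = b)
    (hcross : CrossIntersecting A B)
    (u v : ℝ) (hu3 : 3 ≤ u) (hua : u ≤ (a : ℝ)) (hv3 : 3 ≤ v) (hvb : v ≤ (b : ℝ))
    (hAcard : realChoose ((n : ℝ) - 1) (a - 1) - realChoose ((n : ℝ) - v - 1) (a - 1)
        + realChoose ((n : ℝ) - u - 1) (n - a - 1) ≤ (A.card : ℝ))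
    (hBcard : realChoose ((n : ℝ) - 1) (b - 1) - realChoose ((n : ℝ) - u - 1) (b - 1)
        + realChoose ((n : ℝ) - v - 1) (n - b - 1) ≤ (B.card : ℝ))
    (hstrict :
      realChoose ((n : ℝ) - 1) (a - 1) - realChoose ((n : ℝ) - v - 1) (a - 1)
          + realChoose ((n : ℝ) - u - 1) (n - a - 1) < (A.card : ℝ) ∨
      realChoose ((n : ℝ) - 1) (b - 1) - realChoose ((n : ℝ) - u - 1) (b - 1)
          + realChoose ((n : ℝ) - v - 1) (n - b - 1) < (B.card : ℝ)) :
    (diversity A : ℝ) < realChoose ((n : ℝ) - u - 1) (n - a - 1) ∧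
    (diversity B : ℝ) < realChoose ((n : ℝ) - v - 1) (n - b - 1) ∧
    ∃ i : Fin n, IsUniqueMaxDegree A i ∧ IsUniqueMaxDegree B i := by
  have ha3 : 3 ≤ a := by exact_mod_cast hu3.trans hua
  have hb3 : 3 ≤ b := by exact_mod_cast hv3.trans hvb
  obtain ⟨a, rfl⟩ : ∃ c, a = c + 1 := ⟨a - 1, by omega⟩
  obtain ⟨b, rfl⟩ : ∃ c, b = c + 1 := ⟨b - 1, by omega⟩
  obtain ⟨n, rfl⟩ : ∃ c, n = c + 1 := ⟨n - 1, by omega⟩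
  obtain ⟨l, hl⟩ : ∃ l, a + l + 1 = n := ⟨n - a - 1, by omega⟩
  obtain ⟨l', hl'⟩ : ∃ l', b + l' + 1 = n := ⟨n - b - 1, by omega⟩
  have e1 : n + 1 - (a + 1) - 1 = l := by omega
  have e2 : n + 1 - (b + 1) - 1 = l' := by omega
  have hlR : (a : ℝ) + l + 1 = n := by exact_mod_cast hl
  have hlR' : (b : ℝ) + l' + 1 = n := by exact_mod_cast hl'
  have hnR : (a : ℝ) + b + 1 ≤ n := by exact_mod_cast (by omega : a + b + 1 ≤ n)
  simp only [e1, e2, Nat.add_sub_cancel] at hAcard hBcard hstrict ⊢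
  have en : ((n : ℝ) + 1) - 1 = n := add_sub_cancel_right _ _
  push_cast at hua hvb hAcard hBcard hstrict ⊢
  rw [en] at hAcard hBcard hstrict
  -- u ≤ a + 1 keeps `t` out of the truncated range, so `strictA` holds vacuously; u ≥ 3 gives t ≤ n
  -- - 3.
  have ht : (l : ℝ) ≤ n + 1 - u - 1 := by linarith
  have ht' : (l' : ℝ) ≤ n + 1 - v - 1 := by linarith
  rw [realChoose_of_le ht, realChoose_of_le (by linarith : (a : ℝ) ≤ n + 1 - v - 1),
    realChoose_of_le (by linarith : (a : ℝ) ≤ n),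
    binomPoly_natCast] at hAcard hstrict
  rw [realChoose_of_le ht', realChoose_of_le (by linarith : (b : ℝ) ≤ n + 1 - u - 1),
    realChoose_of_le (by linarith : (b : ℝ) ≤ n),
    binomPoly_natCast] at hBcard hstrict
  rw [realChoose_of_le ht, realChoose_of_le ht']
  rw [← card_valFamily] at hAcard hBcard
  rw [← card_valFamily A, ← card_valFamily B] at hstrict
  have h : LargePair n a b l l' (n + 1 - u - 1) (n + 1 - v - 1) (valFamily A) (valFamily B) :=
    { hal := hl
      hbl := hl'
      hab := by omega
      ha := by omega
      hb := by omega
      subA := valFamily_subset hA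
      subB := valFamily_subset hB
      cross := hcross.crossMeet
      ht := by linarith
      ht' := by linarith
      htn := by linarith
      htn' := by linarith
      cardA := hAcard
      cardB := hBcard
      strict := hstrict
      strictA := fun h => absurd ht (not_le.2 h)
      strictB := fun h => absurd ht' (not_le.2 h) }
  have ha2 : 2 ≤ a := by omega
  have hb2 : 2 ≤ b := by omega
  obtain ⟨i, hi, hcA, hcB⟩ := LargePair.exists_isCenter ha2 hb2 ht ht' _ _ _ rfl h
  refine ⟨?_, ?_, ⟨i, hi⟩, fun j hj => ?_, fun j hj => ?_⟩
  · exact lt_of_le_of_lt (Nat.cast_le.2 (diversity_le A ⟨i, hi⟩)) hcA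
  · exact lt_of_le_of_lt (Nat.cast_le.2 (diversity_le B ⟨i, hi⟩)) hcB
  · rw [← card_member_valFamily, ← card_member_valFamily]
    exact h.member_card_lt_of_nonMember_lt ha2 hi j.2 (fun e => hj (Fin.ext e.symm)) hcA
  · rw [← card_member_valFamily, ← card_member_valFamily]
    exact h.symm.member_card_lt_of_nonMember_lt hb2 hi j.2 (fun e => hj (Fin.ext e.symm)) hcB
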